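/- Fix an integer $k\ge 1$. For $n\ge 2k$ let $J(n,k)$ be the Johnson graph: its $N=\binom nk$ vertices are the $k$-subsets of $\{1,\dots,n\}$, and $v,v'$ are adjacent iff $|v\cap v'|=k-1$. Let $A$ be its adjacency operator on the Hilbert space with orthonormal basis $\{|v\rangle\}$, let $w$ be a marked vertex, and for real $\gamma$ let $H=-\gamma A-|w\rangle\langle w|$. Let $|s\rangle=\frac1{\sqrt N}\sum_v|v\rangle$ and $|\psi(t)\rangle=e^{-iHt}|s\rangle$. Put $\epsilon=1/\sqrt n$ and, for $0\le\ell\le k$, $$r_\ell(\epsilon)=(k-\ell)\bigl(1-(k+\ell)\epsilon^2\bigr)-\ell\epsilon^2,\qquad p_\ell(\epsilon)=\epsilon^{k-\ell}\sqrt{\frac{k!\,(1-(2\ell-1)\epsilon^2)}{\ell!\,\prod_{j=\ell-1}^{k-1}(1-j\epsilon^2)}},$$ $$\gamma^\circ(\epsilon)=\epsilon^2\sum_{\ell=1}^k\frac{p_\ell(\epsilon)^2}{r_0(\epsilon)-r_\ell(\epsilon)},\qquad t_{\mathrm{run}}=\frac{\pi n^{k/2}}{2\sqrt{k!}}.$$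 Then: 1. For all $n\ge 2k$ we have $\gamma^\circ(1/\sqrt n)>0$, and for $0\le\ell\le k$ and every vertex $w$, $r_\ell(1/\sqrt n)=\lambda_\ell/n$ and $p_\ell(1/\sqrt n)=\|P_\ell|w\rangle\|$, where $\lambda_\ell=(k-\ell)(n-k-\ell)-\ell$ and $P_\ell$ is the orthogonal projector onto the eigenspace of $A$ for $\lambda_\ell$. 2. $t_{\mathrm{run}}\big/\bigl(\tfrac{\pi}{2}\sqrt N\bigr)\to 1$ as $n\to\infty$. 3. With $\gamma=\gamma^\circ(1/\sqrt n)$, the success probability satisfies $|\langle w|\psi(t_{\mathrm{run}})\rangle|^2=1+o(1)$ as $n\to\infty$, uniformly in the marked vertex $w$. -/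

import Mathlib

open Filter Topology

noncomputable section

namespace JohnsonSearch

/-- The vertices of `J(n,k)`: the `k`-subsets of an `n`-set. -/
abbrev Vertex (n k : ℕ) : Type := {v : Finset (Fin n) // v.card = k}

/-- The Johnson graph `J(n,k)`: `v` and `v'` are adjacent iff `|v ∩ v'| = k - 1`
(written without subtraction). -/
def johnsonGraph (n k : ℕ) : SimpleGraph (Vertex n k) where
  Adj v v' := (v.1 ∩ v'.1).card + 1 = k
  symm := ⟨fun v v' h => by rw [Finset.inter_comm]; exact h⟩
  loopless := ⟨fun v h => by
    rw [Finset.inter_self, v.2] at h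
    omega⟩

instance (n k : ℕ) : DecidableRel (johnsonGraph n k).Adj :=
  fun v v' => inferInstanceAs (Decidable ((v.1 ∩ v'.1).card + 1 = k))

/-- The Hilbert space with orthonormal basis `|v⟩`, `v` a vertex of `J(n,k)`. -/
abbrev State (n k : ℕ) : Type := EuclideanSpace ℂ (Vertex n k)

/-- The basis state `|v⟩`. -/
def ket {n k : ℕ} (v : Vertex n k) : State n k := EuclideanSpace.single v 1

/-- The adjacency operator `A` of `J(n,k)`. -/
def adjOp (n k : ℕ) : State n k →L[ℂ] State n k :=
  Matrix.toEuclideanCLM (n := Vertex n k) (𝕜 := ℂ) ((johnsonGraph n k).adjMatrix ℂ)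

/-- The Hamiltonian `H = -γ A - |w⟩⟨w|`. -/
def hamiltonian {n k : ℕ} (γ : ℝ) (w : Vertex n k) : State n k →L[ℂ] State n k :=
  -((γ : ℂ) • adjOp n k) - InnerProductSpace.rankOne ℂ (ket w) (ket w)

/-- The uniform superposition `|s⟩`. -/
def uniformState (n k : ℕ) : State n k :=
  ((1 / √(n.choose k : ℝ) : ℝ) : ℂ) • ∑ v : Vertex n k, ket v

/-- The state `ψ(t) = exp(-iHt)|s⟩` at time `t`. -/
def stateAt {n k : ℕ} (γ : ℝ) (w : Vertex n k) (t : ℝ) : State n k :=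
  NormedSpace.exp ((-Complex.I * (t : ℂ)) • hamiltonian γ w) (uniformState n k)

/-- The probability `|⟨w|ψ(t)⟩|²` of measuring `w` at time `t`. -/
def successProb {n k : ℕ} (γ : ℝ) (w : Vertex n k) (t : ℝ) : ℝ :=
  ‖inner ℂ (ket w) (stateAt γ w t)‖ ^ 2

/-- `λ_ℓ = (k-ℓ)(n-k-ℓ) - ℓ`. -/
def eigenval (n k l : ℕ) : ℝ := ((k : ℝ) - l) * ((n : ℝ) - k - l) - l

/-- The orthogonal projector `P_ℓ` onto the eigenspace of `A` for `λ_ℓ`. -/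
def eigenProj (n k l : ℕ) : State n k →L[ℂ] State n k :=
  (Module.End.eigenspace (adjOp n k).toLinearMap ((eigenval n k l : ℝ) : ℂ)).starProjection

/-- `r_ℓ(ε) = (k-ℓ)(1-(k+ℓ)ε²) - ℓε²`. -/
def r (k l : ℕ) (ε : ℝ) : ℝ :=
  ((k : ℝ) - l) * (1 - ((k : ℝ) + l) * ε ^ 2) - l * ε ^ 2

/-- `p_ℓ(ε) = ε^(k-ℓ) √(k! (1-(2ℓ-1)ε²) / (ℓ! (1-(ℓ-1)ε²) ⋯ (1-(k-1)ε²)))`, for `ℓ ≤ k`. -/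
def p (k l : ℕ) (ε : ℝ) : ℝ :=
  ε ^ (k - l) *
    √((k.factorial * (1 - (2 * (l : ℝ) - 1) * ε ^ 2)) /
      (l.factorial * ∏ j ∈ Finset.Icc l k, (1 - ((j : ℝ) - 1) * ε ^ 2)))

/-- `γ°(ε) = ε² ∑_{ℓ=1}^k p_ℓ(ε)² / (r_0(ε) - r_ℓ(ε))`. -/
def gammaCirc (k : ℕ) (ε : ℝ) : ℝ :=
  ε ^ 2 * ∑ l ∈ Finset.Icc 1 k, p k l ε ^ 2 / (r k 0 ε - r k l ε)

/-- `ε = 1/√n`. -/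
def eps (n : ℕ) : ℝ := 1 / √(n : ℝ)

/-- `t_run = π n^(k/2) / (2 √(k!))`. -/
def runTime (n k : ℕ) : ℝ :=
  Real.pi * (n : ℝ) ^ ((k : ℝ) / 2) / (2 * √(k.factorial : ℝ))

end JohnsonSearch

end

/-! Spectral part. Let u_j(v) be the number of j-subsets of v ∩ w, so that u_0 is √N|s⟩ and u_k =
|w⟩. The operator A is bidiagonal on the u_j: A u_{j+1} = λ_{j+1} u_{j+1} + (k-j)² u_j
(`adjOp_subsetCount_succ`). Hence P_l kills u_j for j < l, sends u_l to an explicit eigenvector, and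
sends u_{l+i} to a known multiple of P_l u_l. This yields P_l|w⟩, and Chu–Vandermonde evaluates
‖P_l|w⟩‖² = ⟨w, P_l w⟩ (`norm_sq_eigenProj_ket`). These weights sum to 1 over l ≤ k, so |w⟩ is the
sum of its components P_l|w⟩, without a full diagonalisation of A.

Search part. Put ω = 1/√N and b = ∑_{l≥1} P_l|w⟩ / (γ°(λ_0 - λ_l)). The definition of γ° says
exactly that ⟨w, b⟩ = 1, whence (H + γ°λ_0)s = -ω w and (H + γ°λ_0)b = -ω s
(`hamiltonian_uniformState`, `hamiltonian_partner`). If b were w, the state would rotate from s to w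
with angular speed ω. Duhamel's estimate bounds the error by ωt‖b - w‖ (`norm_exp_sub_rotation_le`).
In terms of ε the quantity ‖b - w‖² is continuous at 0 and vanishes there (`tendsto_partnerError`),
while ω t_run → π/2, so the overlap with w tends to 1 in modulus. All the bounds depend on n and k
only, which gives uniformity in w. -/

noncomputable section

namespace JohnsonSearch

/-! ### Neighbours in the Johnson graph as exchanges of one point. -/

/-- The `k`-set obtained from `v` by exchanging `x ∈ v` for `y ∉ v`. -/
def exchange {n k : ℕ} (v : Vertex n k) (z : Fin n × Fin n) (hx : z.1 ∈ v.1) (hy : z.2 ∉ v.1) :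
    Vertex n k :=
  ⟨insert z.2 (v.1.erase z.1), by
    have := Finset.card_erase_add_one hx
    rw [Finset.card_insert_of_notMem (fun h => hy (Finset.mem_of_mem_erase h)), this, v.2]⟩

theorem sum_neighborFinset {n k : ℕ} (v : Vertex n k) (f : Finset (Fin n) → ℂ) :
    ∑ u ∈ (johnsonGraph n k).neighborFinset v, f u.1
      = ∑ z ∈ v.1 ×ˢ v.1ᶜ, f (insert z.2 (v.1.erase z.1)) := by
  symm
  refine Finset.sum_bij
    (fun z hz => exchange v z (Finset.mem_product.1 hz).1
      (Finset.mem_compl.1 (Finset.mem_product.1 hz).2)) ?_ ?_ ?_ ?_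
  · rintro ⟨x, y⟩ hz
    obtain ⟨hx, hy⟩ := Finset.mem_product.1 hz
    simp only [Finset.mem_compl] at hx hy
    rw [SimpleGraph.mem_neighborFinset]
    change (v.1 ∩ insert y (v.1.erase x)).card + 1 = k
    rw [Finset.inter_insert_of_notMem hy,
      Finset.inter_eq_right.2 (Finset.erase_subset _ _), Finset.card_erase_add_one hx, v.2]
  · rintro ⟨x, y⟩ hz ⟨x', y'⟩ hz' h
    obtain ⟨hx, hy⟩ := Finset.mem_product.1 hz
    obtain ⟨hx', hy'⟩ := Finset.mem_product.1 hz'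
    simp only [Finset.mem_compl] at hx hy hx' hy'
    -- The exchanged pair can be read off from the new set: x is the only point of v that it lacks,
    -- y its only point outside v.
    have h1 : insert y (v.1.erase x) = insert y' (v.1.erase x') := congrArg Subtype.val h
    have ha := Finset.ext_iff.1 h1 x
    have hb := Finset.ext_iff.1 h1 y
    simp only [Finset.mem_insert, Finset.mem_erase] at ha hb
    have hxy : x ≠ y := fun e => hy (e ▸ hx)
    have hxy' : x ≠ y' := fun e => hy' (e ▸ hx)
    ext1 <;> simp only <;> grind
  · rintro u hu
    rw [SimpleGraph.mem_neighborFinset] at hu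
    change (v.1 ∩ u.1).card + 1 = k at hu
    have h1 : (v.1 \ u.1).card = 1 := by
      have := Finset.card_sdiff_add_card_inter v.1 u.1
      have := v.2
      omega
    have h2 : (u.1 \ v.1).card = 1 := by
      have := Finset.card_sdiff_add_card_inter u.1 v.1
      rw [Finset.inter_comm] at this
      have := u.2
      omega
    obtain ⟨x, hx⟩ := Finset.card_eq_one.1 h1
    obtain ⟨y, hy⟩ := Finset.card_eq_one.1 h2
    have hx' : ∀ a, a ∈ v.1 ∧ a ∉ u.1 ↔ a = x := fun a => by
      rw [← Finset.mem_sdiff, hx, Finset.mem_singleton]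
    have hy' : ∀ a, a ∈ u.1 ∧ a ∉ v.1 ↔ a = y := fun a => by
      rw [← Finset.mem_sdiff, hy, Finset.mem_singleton]
    refine ⟨(x, y), ?_, ?_⟩
    · simp only [Finset.mem_product, Finset.mem_compl]
      exact ⟨((hx' x).2 rfl).1, ((hy' y).2 rfl).2⟩
    · apply Subtype.ext
      ext a
      have h3 := hx' a
      have h4 := hy' a
      simp only [exchange, Finset.mem_insert, Finset.mem_erase]
      tauto
  · intro z hz
    rfl

theorem adjOp_apply {n k : ℕ} (x : State n k) (v : Vertex n k) :
    adjOp n k x v = ∑ u ∈ (johnsonGraph n k).neighborFinset v, x u := by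
  change (((johnsonGraph n k).adjMatrix ℂ).mulVec (WithLp.ofLp x)) v = _
  rw [SimpleGraph.adjMatrix_mulVec_apply]

/-! ### Subset-counting vectors and the action of A on them. -/

/-- The vector whose component at `v` counts the `j`-subsets of `v ∩ w`. -/
def subsetCount {n k : ℕ} (w : Vertex n k) (j : ℕ) : State n k :=
  WithLp.toLp 2 fun v => ((v.1 ∩ w.1).card.choose j : ℂ)

theorem subsetCount_apply {n k : ℕ} (w : Vertex n k) (j : ℕ) (v : Vertex n k) :
    subsetCount w j v = ((v.1 ∩ w.1).card.choose j : ℂ) := rfl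

theorem subsetCount_self {n k : ℕ} (w : Vertex n k) : subsetCount w k = ket w := by
  ext v
  rw [subsetCount_apply, ket]
  by_cases h : v = w
  · subst h
    simp [v.2]
  · rw [Nat.choose_eq_zero_of_lt]
    · simp [h]
    · by_contra! hle
      apply h
      have h1 : v.1 ∩ w.1 = v.1 :=
        Finset.eq_of_subset_of_card_le Finset.inter_subset_left (by rw [v.2]; exact hle)
      have h2 : v.1 ∩ w.1 = w.1 :=
        Finset.eq_of_subset_of_card_le Finset.inter_subset_right (by rw [w.2]; exact hle)
      exact Subtype.ext (h1.symm.trans h2)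

theorem inner_ket_left {n k : ℕ} (w : Vertex n k) (x : State n k) :
    inner ℂ (ket w) x = x w := by
  simp [ket, EuclideanSpace.inner_single_left]

theorem inner_ket_subsetCount {n k : ℕ} (w : Vertex n k) (j : ℕ) :
    inner ℂ (ket w) (subsetCount w j) = (k.choose j : ℂ) := by
  rw [inner_ket_left, subsetCount_apply, Finset.inter_self, w.2]

theorem norm_ket {n k : ℕ} (w : Vertex n k) : ‖ket w‖ = 1 := by
  simp [ket]

theorem sum_ite_mem_eq {α : Type*} [DecidableEq α] (s t : Finset α) (a b : ℂ) :
    ∑ x ∈ s, (if x ∈ t then a else b) = (s ∩ t).card * a + (s \ t).card * b := by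
  rw [Finset.sum_ite, Finset.sum_const, Finset.sum_const, nsmul_eq_mul, nsmul_eq_mul,
    Finset.filter_mem_eq_inter, Finset.filter_notMem_eq_sdiff]

theorem card_exchange_inter {α : Type*} [DecidableEq α] {s t : Finset α} {x y : α} (hx : x ∈ s)
    (hy : y ∉ s) : (insert y (s.erase x) ∩ t).card
      = (s ∩ t).card - (if x ∈ t then 1 else 0) + (if y ∈ t then 1 else 0) := by
  have h1 : ((s.erase x) ∩ t).card = (s ∩ t).card - (if x ∈ t then 1 else 0) := by
    rw [Finset.erase_inter]
    split_ifs with h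
    · exact Finset.card_erase_of_mem (Finset.mem_inter.2 ⟨hx, h⟩)
    · rw [Finset.erase_eq_of_notMem (fun h' => h (Finset.mem_inter.1 h').2)]; simp
  split_ifs with h h' h' <;> simp only [h, if_true, if_false] at h1
  · rw [Finset.insert_inter_of_mem h', Finset.card_insert_of_notMem, h1]
    simp [hy]
  · rw [Finset.insert_inter_of_notMem h', h1, add_zero]
  · rw [Finset.insert_inter_of_mem h', Finset.card_insert_of_notMem, h1]
    simp [hy]
  · rw [Finset.insert_inter_of_notMem h', h1, add_zero]

/-- The sum over the `k`-sets `u` adjacent to `v` of a function of `|u ∩ w|`. -/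
theorem sum_neighborFinset_card_inter {n k : ℕ} (v w : Vertex n k) (g : ℕ → ℂ) {i : ℕ}
    (hi : (v.1 ∩ w.1).card = i) :
    ∑ u ∈ (johnsonGraph n k).neighborFinset v, g (u.1 ∩ w.1).card
      = i * ((k - i) * g i + (n - 2 * k + i) * g (i - 1))
        + (k - i) * ((k - i) * g (i + 1) + (n - 2 * k + i) * g i) := by
  have e1 : ((v.1 \ w.1).card : ℂ) = k - i := by
    have := Finset.card_sdiff_add_card_inter v.1 w.1
    rw [hi, v.2] at this
    have h : ((v.1 \ w.1).card : ℂ) + i = k := by exact_mod_cast this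
    linear_combination h
  have e2 : ((v.1ᶜ ∩ w.1).card : ℂ) = k - i := by
    have h : v.1ᶜ ∩ w.1 = w.1 \ v.1 := by ext; simp [and_comm]
    have := Finset.card_sdiff_add_card_inter w.1 v.1
    rw [Finset.inter_comm, hi, w.2] at this
    have h' : ((w.1 \ v.1).card : ℂ) + i = k := by exact_mod_cast this
    rw [h]
    linear_combination h'
  have e3 : ((v.1ᶜ \ w.1).card : ℂ) = n - 2 * k + i := by
    have h1 := Finset.card_sdiff_add_card_inter v.1ᶜ w.1
    have h2 := Finset.card_add_card_compl v.1
    rw [v.2, Fintype.card_fin, ← h1] at h2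
    have h2' : (k : ℂ) + ((v.1ᶜ \ w.1).card + (v.1ᶜ ∩ w.1).card) = n := by exact_mod_cast h2
    rw [e2] at h2'
    linear_combination h2'
  have key : ∀ z ∈ v.1 ×ˢ v.1ᶜ, g (insert z.2 (v.1.erase z.1) ∩ w.1).card
      = if z.1 ∈ w.1 then (if z.2 ∈ w.1 then g i else g (i - 1))
        else (if z.2 ∈ w.1 then g (i + 1) else g i) := by
    rintro ⟨x, y⟩ hz
    obtain ⟨hx, hy⟩ := Finset.mem_product.1 hz
    simp only [Finset.mem_compl] at hx hy ⊢
    rw [card_exchange_inter hx hy, hi]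
    split_ifs with h h' h'
    -- A point of w leaves and another enters; in truncated subtraction, i - 1 + 1 = i needs i > 0.
    · have : 0 < i := by
        rw [← hi]; exact Finset.card_pos.2 ⟨x, Finset.mem_inter.2 ⟨hx, h⟩⟩
      congr 1; omega
    · rfl
    · rfl
    · rfl
  rw [sum_neighborFinset v (fun s => g (s ∩ w.1).card), Finset.sum_congr rfl key,
    Finset.sum_product]
  have inner_sum : ∀ x : Fin n, (∑ y ∈ v.1ᶜ, if x ∈ w.1 then (if y ∈ w.1 then g i else g (i - 1))
        else (if y ∈ w.1 then g (i + 1) else g i))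
      = if x ∈ w.1 then ((k - i) * g i + (n - 2 * k + i) * g (i - 1))
        else ((k - i) * g (i + 1) + (n - 2 * k + i) * g i) := by
    intro x
    split_ifs
    · rw [sum_ite_mem_eq, e2, e3]
    · rw [sum_ite_mem_eq, e2, e3]
  simp only [inner_sum]
  rw [sum_ite_mem_eq, e1, hi]

/-- At v the sum over neighbours depends only on i = |v ∩ w|, so the claim is an identity between
binomials in i. Pascal's rule and two absorption identities reduce it to polynomial algebra. -/
theorem adjOp_subsetCount_succ {n k : ℕ} (w : Vertex n k) (j : ℕ) :
    adjOp n k (subsetCount w (j + 1)) = (eigenval n k (j + 1) : ℂ) • subsetCount w (j + 1)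
      + ((k : ℂ) - j) ^ 2 • subsetCount w j := by
  ext v
  rw [adjOp_apply]
  simp only [subsetCount_apply, PiLp.add_apply, PiLp.smul_apply, smul_eq_mul]
  rw [sum_neighborFinset_card_inter v w (fun m => (m.choose (j + 1) : ℂ)) rfl]
  generalize (v.1 ∩ w.1).card = i
  have hs : ((i + 1).choose (j + 1) : ℂ) = i.choose j + i.choose (j + 1) := by
    exact_mod_cast Nat.choose_succ_succ i j
  have hm : ((i : ℂ) - j) * i.choose j = (j + 1) * i.choose (j + 1) := by
    rcases le_or_gt j i with h | h
    · have := Nat.choose_succ_right_eq i j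
      have h' : ((i.choose (j + 1) : ℕ) : ℂ) * (j + 1) = i.choose j * ((i - j : ℕ) : ℂ) := by
        exact_mod_cast this
      rw [Nat.cast_sub h] at h'
      linear_combination -h'
    · rw [Nat.choose_eq_zero_of_lt h, Nat.choose_eq_zero_of_lt (by omega)]; simp
  have hp : (i : ℂ) * (i - 1).choose (j + 1) = (i - j - 1) * i.choose (j + 1) := by
    rcases i with _ | i
    · simp
    · have h1 : (((i + 1 : ℕ) : ℂ)) * i.choose j = (i + 1).choose (j + 1) * (j + 1) := by
        exact_mod_cast Nat.add_one_mul_choose_eq i j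
      have h2 : ((i + 1).choose (j + 1) : ℂ) = i.choose j + i.choose (j + 1) := by
        exact_mod_cast Nat.choose_succ_succ i j
      simp only [Nat.add_sub_cancel]
      push_cast at h1 h2 ⊢
      linear_combination (-(i : ℂ) - 1) * h2 - h1
  have he : ((eigenval n k (j + 1) : ℝ) : ℂ)
      = ((k : ℂ) - (j + 1)) * ((n : ℂ) - k - (j + 1)) - (j + 1) := by
    simp [eigenval]
  simp only [hs, he]
  linear_combination ((n : ℂ) - 2 * k + i) * hp + (i + j - 2 * (k : ℂ)) * hm

theorem adjOp_subsetCount_zero {n k : ℕ} (w : Vertex n k) :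
    adjOp n k (subsetCount w 0) = (eigenval n k 0 : ℂ) • subsetCount w 0 := by
  ext v
  rw [adjOp_apply]
  simp only [subsetCount_apply, PiLp.smul_apply, smul_eq_mul]
  rw [sum_neighborFinset_card_inter v w (fun m => (m.choose 0 : ℂ)) rfl]
  simp [eigenval]
  ring

theorem adjOp_isSymmetric (n k : ℕ) : (adjOp n k).toLinearMap.IsSymmetric := by
  have h : (adjOp n k).toLinearMap
      = Matrix.toEuclideanLin ((johnsonGraph n k).adjMatrix ℂ) :=
    Matrix.coe_toEuclideanCLM_eq_toEuclideanLin _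
  rw [h, Matrix.isSymmetric_toEuclideanLin_iff]
  ext i j
  simp [SimpleGraph.adjMatrix_apply, SimpleGraph.adj_comm]

/-! ### Factorial products and the Chu–Vandermonde sum. -/

theorem prod_range_add_one_add_mul_factorial {F : Type*} [Field F] (b a : ℕ) :
    (∏ i ∈ Finset.range a, ((b : F) + 1 + i)) * b.factorial = (b + a).factorial := by
  induction a with
  | zero => simp
  | succ a ih =>
    rw [Finset.prod_range_succ, mul_right_comm, ih, ← add_assoc, Nat.factorial_succ]
    push_cast; ring

theorem prod_range_add_sub_mul_factorial {F : Type*} [Field F] (d m : ℕ) :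
    (∏ i ∈ Finset.range d, ((d : F) + m - i)) * m.factorial = (d + m).factorial := by
  induction d with
  | zero => simp
  | succ d ih =>
    have h : ∀ i : ℕ, ((d + 1 : ℕ) : F) + m - ((i + 1 : ℕ) : F) = d + m - i := by
      intro i; push_cast; ring
    rw [Finset.prod_range_succ', mul_right_comm]
    simp only [h]
    rw [ih, show d + 1 + m = (d + m) + 1 by ring, Nat.factorial_succ]
    push_cast; ring

/-- The Chu–Vandermonde summation `₂F₁(-l, b; c; 1) = (c - b)_l / (c)_l`. -/
theorem chu_vandermonde {F : Type*} [Field F] (l : ℕ) (b c : F) (hc : ∀ i : ℕ, c + i ≠ 0) :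
    ∑ i ∈ Finset.range (l + 1), (-1) ^ i * (l.choose i : F)
        * ∏ s ∈ Finset.range i, ((b + s) / (c + s))
      = ∏ i ∈ Finset.range l, ((c - b + i) / (c + i)) := by
  induction l generalizing b c with
  | zero => simp
  | succ l ih =>
    have hc' : ∀ i : ℕ, c + 1 + i ≠ 0 := fun i => by
      have := hc (i + 1); push_cast at this; rwa [add_assoc, add_comm (1 : F)]
    have hc0 : c ≠ 0 := by simpa using hc 0
    have hshift : ∀ i : ℕ, ∏ s ∈ Finset.range (i + 1), ((b + s) / (c + s))
        = b / c * ∏ s ∈ Finset.range i, ((b + 1 + s) / (c + 1 + s)) := by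
      intro i
      rw [Finset.prod_range_succ', mul_comm]
      congr 1
      · simp
      · refine Finset.prod_congr rfl fun s _ => ?_
        push_cast; congr 1 <;> ring
    -- Pascal's rule gives F_{l+1}(b, c) = F_l(b, c) - (b/c) F_l(b+1, c+1). The shift keeps c - b
    -- fixed, so the two values from the induction have the same numerator.
    have hsplit : ∑ i ∈ Finset.range (l + 1 + 1), (-1) ^ i * ((l + 1).choose i : F)
          * ∏ s ∈ Finset.range i, ((b + s) / (c + s))
        = (∑ i ∈ Finset.range (l + 1), (-1) ^ i * (l.choose i : F)
            * ∏ s ∈ Finset.range i, ((b + s) / (c + s)))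
          - b / c * ∑ i ∈ Finset.range (l + 1), (-1) ^ i * (l.choose i : F)
            * ∏ s ∈ Finset.range i, ((b + 1 + s) / (c + 1 + s)) := by
      rw [Finset.sum_range_succ']
      have hext : ∑ i ∈ Finset.range (l + 1), (-1) ^ i * (l.choose i : F)
            * ∏ s ∈ Finset.range i, ((b + s) / (c + s))
          = ∑ i ∈ Finset.range (l + 1 + 1), (-1) ^ i * (l.choose i : F)
            * ∏ s ∈ Finset.range i, ((b + s) / (c + s)) := by
        rw [Finset.sum_range_succ _ (l + 1)]; simp
      rw [hext, Finset.sum_range_succ' (fun i => (-1) ^ i * (l.choose i : F)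
        * ∏ s ∈ Finset.range i, ((b + s) / (c + s))), Finset.mul_sum, add_sub_right_comm,
        ← Finset.sum_sub_distrib]
      congr 1
      · refine Finset.sum_congr rfl fun i _ => ?_
        rw [hshift, Nat.choose_succ_succ]
        push_cast; ring
      · simp
    rw [hsplit, ih b c hc, ih (b + 1) (c + 1) hc']
    have hnum : ∀ i : ℕ, c + 1 - (b + 1) + (i : F) = c - b + i := fun i => by ring
    simp only [hnum, Finset.prod_div_distrib]
    have hden : c * ∏ i ∈ Finset.range l, (c + 1 + (i : F))
        = (∏ i ∈ Finset.range l, (c + (i : F))) * (c + l) := by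
      rw [← Finset.prod_range_succ, Finset.prod_range_succ', mul_comm]
      congr 1
      · refine Finset.prod_congr rfl fun i _ => ?_
        push_cast; ring
      · simp
    have h1 : ∏ i ∈ Finset.range l, (c + (i : F)) ≠ 0 :=
      Finset.prod_ne_zero_iff.2 fun i _ => hc i
    have h2 : ∏ i ∈ Finset.range l, (c + 1 + (i : F)) ≠ 0 :=
      Finset.prod_ne_zero_iff.2 fun i _ => hc' i
    have h3 := hc l
    rw [Finset.prod_range_succ, Finset.prod_range_succ, ← hden,
      ← mul_div_mul_right _ _ h3, ← hden]
    field_simp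
    ring

/-! ### Eigenprojections of the marked state. -/

theorem eigenval_sub (n k l j : ℕ) :
    eigenval n k l - eigenval n k j = ((j : ℝ) - l) * (n + 1 - l - j) := by
  simp only [eigenval]; ring

theorem eigenval_lt {n k l j : ℕ} (hn : 2 * k ≤ n) (hj : j ≤ k) (hlj : l < j) :
    eigenval n k j < eigenval n k l := by
  have h1 : (l : ℝ) + 1 ≤ j := by exact_mod_cast hlj
  have h2 : (l : ℝ) + j ≤ n := by exact_mod_cast (by omega : l + j ≤ n)
  have := eigenval_sub n k l j
  nlinarith

theorem eigenval_injOn {n k l j : ℕ} (hn : 2 * k ≤ n) (hl : l ≤ k) (hj : j ≤ k)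
    (h : l ≠ j) : eigenval n k l ≠ eigenval n k j := by
  rcases lt_or_gt_of_ne h with h | h
  · exact (eigenval_lt hn hj h).ne'
  · exact (eigenval_lt hn hl h).ne

theorem eigenProj_mem (n k l : ℕ) (x : State n k) :
    eigenProj n k l x ∈ Module.End.eigenspace (adjOp n k).toLinearMap (eigenval n k l : ℂ) :=
  Submodule.starProjection_apply_mem _ _

theorem adjOp_eigenProj (n k l : ℕ) (x : State n k) :
    adjOp n k (eigenProj n k l x) = (eigenval n k l : ℂ) • eigenProj n k l x :=
  Module.End.mem_eigenspace_iff.1 (eigenProj_mem n k l x)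

/-- A is symmetric, hence preserves the orthogonal complement of each of its eigenspaces. -/
theorem eigenProj_adjOp (n k l : ℕ) (x : State n k) :
    eigenProj n k l (adjOp n k x) = (eigenval n k l : ℂ) • eigenProj n k l x := by
  refine Submodule.eq_starProjection_of_mem_orthogonal
    (Submodule.smul_mem _ _ (eigenProj_mem n k l x)) ?_
  rw [← adjOp_eigenProj, ← map_sub, Submodule.mem_orthogonal]
  intro y hy
  have h1 := adjOp_isSymmetric n k y (x - eigenProj n k l x)
  have h2 : (adjOp n k).toLinearMap y = (eigenval n k l : ℂ) • y :=
    Module.End.mem_eigenspace_iff.1 hy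
  rw [h2, inner_smul_left] at h1
  refine h1.symm.trans ?_
  have h3 : inner ℂ y (x - eigenProj n k l x) = 0 :=
    (Submodule.mem_orthogonal _ _).1 (Submodule.sub_starProjection_mem_orthogonal x) y hy
  rw [h3, mul_zero]

theorem inner_eigenProj_self {n k : ℕ} (l : ℕ) (x : State n k) :
    inner ℂ x (eigenProj n k l x) = ((‖eigenProj n k l x‖ ^ 2 : ℝ) : ℂ) := by
  have h : eigenProj n k l (eigenProj n k l x) = eigenProj n k l x :=
    Submodule.starProjection_eq_self_iff.2 (eigenProj_mem n k l x)
  have h2 := Submodule.inner_starProjection_left_eq_right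
    (Module.End.eigenspace (adjOp n k).toLinearMap (eigenval n k l : ℂ)) x (eigenProj n k l x)
  change inner ℂ (eigenProj n k l x) _ = inner ℂ x (eigenProj n k l (eigenProj n k l x)) at h2
  rw [h] at h2
  rw [← h2, inner_self_eq_norm_sq_to_K]
  norm_cast

theorem inner_eigenProj_eigenProj {n k l j : ℕ} (h : eigenval n k l ≠ eigenval n k j)
    (x y : State n k) : inner ℂ (eigenProj n k l x) (eigenProj n k j y) = 0 := by
  have h1 := adjOp_isSymmetric n k (eigenProj n k l x) (eigenProj n k j y)
  change inner ℂ (adjOp n k _) _ = inner ℂ _ (adjOp n k _) at h1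
  rw [adjOp_eigenProj, adjOp_eigenProj, inner_smul_left, inner_smul_right, Complex.conj_ofReal,
    ← sub_eq_zero, ← sub_mul] at h1
  refine (mul_eq_zero.1 h1).resolve_left ?_
  rw [sub_eq_zero]
  exact_mod_cast h

/-- Applying P_l to the bidiagonal relation gives a one-step recursion in j. It propagates zero
below l and determines everything above l from P_l u_l. -/
theorem eigenProj_subsetCount_succ {n k : ℕ} (l j : ℕ) (w : Vertex n k) :
    ((eigenval n k l - eigenval n k (j + 1) : ℝ) : ℂ) • eigenProj n k l (subsetCount w (j + 1))
      = ((k : ℂ) - j) ^ 2 • eigenProj n k l (subsetCount w j) := by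
  have h := eigenProj_adjOp n k l (subsetCount w (j + 1))
  rw [adjOp_subsetCount_succ, map_add, map_smul, map_smul] at h
  rw [Complex.ofReal_sub, sub_smul, ← h, add_sub_cancel_left]

theorem eigenProj_subsetCount_of_lt {n k l j : ℕ} (hn : 2 * k ≤ n) (hl : l ≤ k) (hj : j < l)
    (w : Vertex n k) : eigenProj n k l (subsetCount w j) = 0 := by
  induction j with
  | zero =>
    have h := eigenProj_adjOp n k l (subsetCount w 0)
    rw [adjOp_subsetCount_zero, map_smul, ← sub_eq_zero, ← sub_smul] at h
    refine (smul_eq_zero.1 h).resolve_left ?_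
    rw [sub_eq_zero]
    exact_mod_cast eigenval_injOn hn (by omega) hl (by omega)
  | succ j ih =>
    have h := eigenProj_subsetCount_succ l j w
    rw [ih (by omega), smul_zero] at h
    refine (smul_eq_zero.1 h).resolve_left ?_
    exact_mod_cast sub_ne_zero.2 (eigenval_injOn hn hl (by omega) (by omega))

/-- The ratio between `P_l u_{l+i}` and `P_l u_l`, where `u_j` is `subsetCount w j`. -/
def projRatio (n k l i : ℕ) : ℂ :=
  ∏ s ∈ Finset.range i, (((k : ℂ) - l - s) ^ 2 / ((s + 1) * ((n : ℂ) - 2 * l - s)))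

theorem eigenProj_subsetCount_add {n k l i : ℕ} (hn : 2 * k ≤ n) (hi : l + i ≤ k)
    (w : Vertex n k) : eigenProj n k l (subsetCount w (l + i))
      = projRatio n k l i • eigenProj n k l (subsetCount w l) := by
  induction i with
  | zero => simp [projRatio]
  | succ i ih =>
    have h := eigenProj_subsetCount_succ l (l + i) w
    rw [ih (by omega), eigenval_sub] at h
    have h1 : ((((l + i + 1 : ℕ) : ℝ) - l) * (n + 1 - l - ((l + i + 1 : ℕ) : ℝ)) : ℝ)
        = ((i + 1 : ℝ) * ((n : ℝ) - 2 * l - i)) := by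
      push_cast; ring
    have hne : ((i : ℂ) + 1) * ((n : ℂ) - 2 * l - i) ≠ 0 := by
      have ha : ((i + 1 : ℕ) : ℂ) ≠ 0 := by exact_mod_cast Nat.succ_ne_zero i
      have hb : ((n - (2 * l + i) : ℕ) : ℂ) ≠ 0 := by
        exact_mod_cast (by omega : n - (2 * l + i) ≠ 0)
      rw [Nat.cast_sub (by omega)] at hb
      push_cast at ha hb
      rw [← sub_sub] at hb
      exact mul_ne_zero ha hb
    rw [h1] at h
    push_cast at h
    rw [← add_assoc, ← inv_smul_smul₀ hne (eigenProj n k l (subsetCount w (l + i + 1))), h,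
      smul_smul, smul_smul, projRatio, projRatio, Finset.prod_range_succ]
    congr 1
    rw [div_eq_mul_inv]; ring

/-- The coefficients, along `subsetCount w (l - i)`, of the eigenvector for `λ_l`. -/
def eigenvecCoeff (n k l i : ℕ) : ℂ :=
  ∏ s ∈ Finset.range i, (-((k : ℂ) - l + 1 + s) ^ 2 / ((s + 1) * ((n : ℂ) + 2 - 2 * l + s)))

/-- The eigenvector of the adjacency operator for `λ_l` that is spanned by
`subsetCount w j`, `j ≤ l`, with coefficient `1` along `subsetCount w l`. -/
def eigenvec {n k : ℕ} (w : Vertex n k) (l : ℕ) : State n k :=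
  ∑ i ∈ Finset.range (l + 1), eigenvecCoeff n k l i • subsetCount w (l - i)

theorem add_two_sub_ne_zero {n l : ℕ} (h : 2 * l ≤ n) (s : ℕ) :
    (n : ℂ) + 2 - 2 * l + s ≠ 0 := by
  have hb : ((n + 2 - 2 * l + s : ℕ) : ℂ) ≠ 0 := by
    exact_mod_cast (by omega : n + 2 - 2 * l + s ≠ 0)
  push_cast [Nat.cast_sub (by omega : 2 * l ≤ n + 2)] at hb
  exact hb

theorem eigenvecCoeff_succ {n k l : ℕ} (h : 2 * l ≤ n) (i : ℕ) :
    eigenvecCoeff n k l (i + 1) * ((i + 1) * ((n : ℂ) + 2 - 2 * l + i))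
      = -((k : ℂ) - l + 1 + i) ^ 2 * eigenvecCoeff n k l i := by
  have hne := add_two_sub_ne_zero h i
  have hi : (i : ℂ) + 1 ≠ 0 := by exact_mod_cast Nat.succ_ne_zero i
  rw [eigenvecCoeff, Finset.prod_range_succ, ← eigenvecCoeff, mul_assoc,
    div_mul_cancel₀ _ (mul_ne_zero hi hne), mul_comm]

theorem eigenvec_mem {n k l : ℕ} (hn : 2 * k ≤ n) (hl : l ≤ k) (w : Vertex n k) :
    eigenvec w l ∈ Module.End.eigenspace (adjOp n k).toLinearMap (eigenval n k l : ℂ) := by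
  rw [Module.End.mem_eigenspace_iff]
  change adjOp n k (eigenvec w l) = _
  -- A truncated sum fails the eigenvector equation only by a multiple of the next vector u_{l-m},
  -- and the next coefficient is chosen to absorb it. The process closes at u_0, which A sends to a
  -- multiple of itself.
  have partial_sum : ∀ m ≤ l, adjOp n k
        (∑ i ∈ Finset.range m, eigenvecCoeff n k l i • subsetCount w (l - i))
      = (eigenval n k l : ℂ) •
          (∑ i ∈ Finset.range m, eigenvecCoeff n k l i • subsetCount w (l - i))
        - (eigenvecCoeff n k l m * (m * ((n : ℂ) + 1 - 2 * l + m))) • subsetCount w (l - m) := by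
    intro m hm
    induction m with
    | zero => simp
    | succ m ih =>
      obtain ⟨j, hj⟩ : ∃ j, l = j + 1 + m := ⟨l - m - 1, by omega⟩
      have e1 : l - m = j + 1 := by omega
      have e2 : l - (m + 1) = j := by omega
      have hc := eigenvecCoeff_succ (k := k) (by omega : 2 * l ≤ n) m
      have hlam : (eigenval n k (j + 1) : ℂ)
          = eigenval n k l + m * ((n : ℂ) + 1 - 2 * l + m) := by
        have := eigenval_sub n k l (j + 1)
        have hj' : ((j + 1 : ℕ) : ℝ) = l - m := by rw [hj]; push_cast; ring
        rw [hj'] at this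
        have h3 : eigenval n k (j + 1) = eigenval n k l + m * ((n : ℝ) + 1 - 2 * l + m) := by
          linear_combination -this
        rw [h3]; push_cast; ring
      have hkj : (k : ℂ) - j = k - l + 1 + m := by rw [hj]; push_cast; ring
      have hcoef : eigenvecCoeff n k l (m + 1)
            * (((m + 1 : ℕ) : ℂ) * ((n : ℂ) + 1 - 2 * l + ((m + 1 : ℕ) : ℂ)))
          = -((k : ℂ) - l + 1 + m) ^ 2 * eigenvecCoeff n k l m := by
        rw [← hc]; push_cast; ring
      rw [Finset.sum_range_succ, map_add, ih (by omega), map_smul, e1, adjOp_subsetCount_succ,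
        hcoef, hlam, hkj, e2]
      module
  rw [eigenvec, Finset.sum_range_succ, map_add, partial_sum l le_rfl, map_smul, Nat.sub_self,
    adjOp_subsetCount_zero]
  have hlam : (eigenval n k 0 : ℂ) = eigenval n k l + l * ((n : ℂ) + 1 - 2 * l + l) := by
    have := eigenval_sub n k l 0
    have h3 : eigenval n k 0 = eigenval n k l + l * ((n : ℝ) + 1 - 2 * l + l) := by
      push_cast at this; linear_combination -this
    rw [h3]; push_cast; ring
  rw [hlam]
  module

/-- The vector `eigenvec w l` is fixed by P_l and differs from u_l by a combination of u_j with j <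
l, all killed by P_l. -/
theorem eigenProj_subsetCount_self {n k l : ℕ} (hn : 2 * k ≤ n) (hl : l ≤ k) (w : Vertex n k) :
    eigenProj n k l (subsetCount w l) = eigenvec w l := by
  have h : eigenProj n k l (eigenvec w l) = eigenvec w l :=
    Submodule.starProjection_eq_self_iff.2 (eigenvec_mem hn hl w)
  rw [← h, eigenvec, map_sum, Finset.sum_range_succ', Finset.sum_eq_zero]
  · simp [eigenvecCoeff]
  · intro i hi
    have := Finset.mem_range.1 hi
    rw [map_smul, eigenProj_subsetCount_of_lt hn hl (by omega), smul_zero]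

theorem eigenProj_ket {n k l : ℕ} (hn : 2 * k ≤ n) (hl : l ≤ k) (w : Vertex n k) :
    eigenProj n k l (ket w) = projRatio n k l (k - l) • eigenvec w l := by
  have h := eigenProj_subsetCount_add (l := l) (i := k - l) hn (by omega) w
  rwa [Nat.add_sub_cancel' hl, subsetCount_self, eigenProj_subsetCount_self hn hl] at h

/-- Passing from C(k, l) to C(k, l-i) cancels one of the two factors k-l+1+s of each square and
supplies C(l, i). What remains is a Chu–Vandermonde term with b = k-l+1 and c = n+2-2l. -/
theorem eigenvecCoeff_mul_choose {n k l i : ℕ} (hl : l ≤ k) (hi : i ≤ l) (h : 2 * l ≤ n) :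
    eigenvecCoeff n k l i * (k.choose (l - i) : ℂ)
      = k.choose l * ((-1) ^ i * (l.choose i : ℂ)
        * ∏ s ∈ Finset.range i, (((k : ℂ) - l + 1 + s) / ((n : ℂ) + 2 - 2 * l + s))) := by
  induction i with
  | zero => simp [eigenvecCoeff]
  | succ i ih =>
    have ih := ih (by omega)
    obtain ⟨j, rfl⟩ : ∃ j, l = j + 1 + i := ⟨l - i - 1, by omega⟩
    obtain ⟨d, rfl⟩ : ∃ d, k = j + 1 + i + d := ⟨k - (j + 1 + i), by omega⟩
    have hc := eigenvecCoeff_succ (k := j + 1 + i + d) h i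
    have hne := add_two_sub_ne_zero h i
    have h1 : ((j + 1 + i + d).choose (j + 1) : ℂ) * (j + 1)
        = (j + 1 + i + d).choose j * (i + d + 1) := by
      have := Nat.choose_succ_right_eq (j + 1 + i + d) j
      rw [show j + 1 + i + d - j = i + d + 1 by omega] at this
      exact_mod_cast this
    have h2 : ((j + 1 + i).choose (i + 1) : ℂ) * (i + 1) = (j + 1 + i).choose i * (j + 1) := by
      have := Nat.choose_succ_right_eq (j + 1 + i) i
      rw [show j + 1 + i - i = j + 1 by omega] at this
      exact_mod_cast this
    have hi1 : (i : ℂ) + 1 ≠ 0 := by exact_mod_cast Nat.succ_ne_zero i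
    have hid : (i : ℂ) + d + 1 ≠ 0 := by exact_mod_cast Nat.succ_ne_zero (i + d)
    rw [show j + 1 + i - i = j + 1 by omega] at ih
    rw [show j + 1 + i - (i + 1) = j by omega, Finset.prod_range_succ]
    generalize (∏ s ∈ Finset.range i, ((((j + 1 + i + d : ℕ) : ℂ) - ((j + 1 + i : ℕ) : ℂ) + 1 + s)
      / ((n : ℂ) + 2 - 2 * ((j + 1 + i : ℕ) : ℂ) + s))) = Q at *
    have hkl : ((j + 1 + i + d : ℕ) : ℂ) - ((j + 1 + i : ℕ) : ℂ) + 1 + i = i + d + 1 := by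
      push_cast; ring
    rw [hkl] at hc ⊢
    generalize (n : ℂ) + 2 - 2 * ((j + 1 + i : ℕ) : ℂ) + i = D at *
    generalize eigenvecCoeff n (j + 1 + i + d) (j + 1 + i) (i + 1) = a at *
    generalize eigenvecCoeff n (j + 1 + i + d) (j + 1 + i) i = a' at *
    rw [← mul_left_inj' (mul_ne_zero hi1 hne), ← mul_left_inj' hid]
    have hD : Q * ((i + d + 1) / D) * D = Q * (i + d + 1) := by field_simp
    rw [pow_succ]
    linear_combination ((j + 1 + i + d).choose j : ℂ) * (i + d + 1) * hc
      + (i + d + 1 : ℂ) ^ 2 * a' * h1 - (i + d + 1 : ℂ) ^ 2 * (j + 1) * ih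
      + ((j + 1 + i + d).choose (j + 1 + i) : ℂ) * (-1) ^ i * ((i : ℂ) + d + 1) * (i + 1)
        * ((j + 1 + i).choose (i + 1)) * hD
      + ((j + 1 + i + d).choose (j + 1 + i) : ℂ) * (-1) ^ i * ((i : ℂ) + d + 1) ^ 2 * Q * h2

theorem inner_ket_eigenvec {n k l : ℕ} (hn : 2 * k ≤ n) (hl : l ≤ k) (w : Vertex n k) :
    inner ℂ (ket w) (eigenvec w l) = (k.choose l : ℂ) * ∏ i ∈ Finset.range l,
      (((n : ℂ) + 1 - l - k + i) / ((n : ℂ) + 2 - 2 * l + i)) := by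
  rw [eigenvec, inner_sum]
  have h : ∀ i ∈ Finset.range (l + 1),
      inner ℂ (ket w) (eigenvecCoeff n k l i • subsetCount w (l - i))
        = k.choose l * ((-1) ^ i * (l.choose i : ℂ)
        * ∏ s ∈ Finset.range i, (((k : ℂ) - l + 1 + s) / ((n : ℂ) + 2 - 2 * l + s))) := by
    intro i hi
    rw [inner_smul_right, inner_ket_subsetCount]
    exact eigenvecCoeff_mul_choose hl (by have := Finset.mem_range.1 hi; omega) (by omega)
  rw [Finset.sum_congr rfl h, ← Finset.mul_sum,
    chu_vandermonde l _ _ (add_two_sub_ne_zero (by omega))]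
  congr 1
  refine Finset.prod_congr rfl fun i _ => ?_
  congr 1
  ring

/-- The right-hand side is (C(n, l) - C(n, l-1)) / C(n, k), which is why the weights telescope in
`sum_p_eps_sq`. -/
theorem norm_sq_eigenProj_ket {n k l : ℕ} (hn : 2 * k ≤ n) (hl : l ≤ k) (w : Vertex n k) :
    ‖eigenProj n k l (ket w)‖ ^ 2
      = (k.factorial * (n - k).factorial * ((n : ℝ) + 1 - 2 * l))
        / (l.factorial * (n + 1 - l).factorial) := by
  obtain ⟨d, rfl⟩ := Nat.exists_eq_add_of_le hl
  -- With k = l + d and n = 2l + d + m every natural subtraction becomes a sum, and each product a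
  -- quotient of factorials.
  obtain ⟨m, rfl⟩ : ∃ m, n = 2 * l + d + m := ⟨n - (2 * l + d), by omega⟩
  have h := inner_eigenProj_self l (ket w)
  rw [eigenProj_ket hn hl, inner_smul_right, inner_ket_eigenvec hn hl, ← eigenProj_ket hn hl,
    Nat.add_sub_cancel_left, projRatio] at h
  rw [← Complex.ofReal_inj, ← h, Finset.prod_div_distrib, Finset.prod_div_distrib,
    Finset.prod_pow, Finset.prod_mul_distrib, Nat.choose_eq_factorial_div_factorial hl,
    Nat.add_sub_cancel_left,
    Nat.cast_div (Nat.factorial_mul_factorial_dvd_factorial_add l d)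
      (by exact_mod_cast (mul_pos l.factorial_pos d.factorial_pos).ne')]
  have a1 := prod_range_add_sub_mul_factorial (F := ℂ) d 0
  have a2 := prod_range_add_one_add_mul_factorial (F := ℂ) 0 d
  have a3 := prod_range_add_sub_mul_factorial (F := ℂ) d m
  have a4 := prod_range_add_one_add_mul_factorial (F := ℂ) m l
  have a5 := prod_range_add_one_add_mul_factorial (F := ℂ) (d + m + 1) l
  have b1 : ∏ i ∈ Finset.range d, (((l + d : ℕ) : ℂ) - l - i)
      = ∏ i ∈ Finset.range d, ((d : ℂ) + (0 : ℕ) - i) :=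
    Finset.prod_congr rfl fun i _ => by push_cast; ring
  have b2 : ∏ i ∈ Finset.range d, ((i : ℂ) + 1)
      = ∏ i ∈ Finset.range d, (((0 : ℕ) : ℂ) + 1 + i) :=
    Finset.prod_congr rfl fun i _ => by push_cast; ring
  have b3 : ∏ i ∈ Finset.range d, (((2 * l + d + m : ℕ) : ℂ) - 2 * l - i)
      = ∏ i ∈ Finset.range d, ((d : ℂ) + m - i) :=
    Finset.prod_congr rfl fun i _ => by push_cast; ring
  have b4 : ∏ i ∈ Finset.range l, (((2 * l + d + m : ℕ) : ℂ) + 1 - l - (l + d : ℕ) + i)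
      = ∏ i ∈ Finset.range l, ((m : ℂ) + 1 + i) :=
    Finset.prod_congr rfl fun i _ => by push_cast; ring
  have b5 : ∏ i ∈ Finset.range l, (((2 * l + d + m : ℕ) : ℂ) + 2 - 2 * l + i)
      = ∏ i ∈ Finset.range l, (((d + m + 1 : ℕ) : ℂ) + 1 + i) :=
    Finset.prod_congr rfl fun i _ => by push_cast; ring
  have fne : ∀ a : ℕ, ((a.factorial : ℕ) : ℂ) ≠ 0 := fun a => by
    exact_mod_cast a.factorial_ne_zero
  rw [b1, b2, b3, b4, b5, eq_div_of_mul_eq (fne _) a1, eq_div_of_mul_eq (fne _) a2,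
    eq_div_of_mul_eq (fne _) a3, eq_div_of_mul_eq (fne _) a4, eq_div_of_mul_eq (fne _) a5,
    show 2 * l + d + m - (l + d) = m + l by omega,
    show 2 * l + d + m + 1 - l = d + m + 1 + l by omega]
  have hs : (((d + m + 1).factorial : ℕ) : ℂ) = (d + m + 1) * (d + m).factorial := by
    rw [Nat.factorial_succ]; push_cast; ring
  have f1 := fne l
  have f2 := fne d
  have f3 := fne m
  have f4 := fne (d + m)
  have f5 := fne (d + m + 1 + l)
  simp only [add_zero, zero_add, Nat.factorial_zero, Nat.cast_one, div_one, hs]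
  push_cast
  field_simp
  ring

/-! ### The functions r, p and γ° at ε = 1/√n. -/

theorem eps_sq (n : ℕ) : eps n ^ 2 = 1 / (n : ℝ) := by
  rw [eps, div_pow, one_pow, Real.sq_sqrt (Nat.cast_nonneg n)]

theorem r_eps {n : ℕ} (hn : 0 < n) (k l : ℕ) :
    r k l (eps n) = eps n ^ 2 * eigenval n k l := by
  have : (n : ℝ) ≠ 0 := by exact_mod_cast hn.ne'
  rw [r, eigenval, eps_sq]
  field_simp
  ring

theorem p_nonneg (k l n : ℕ) : 0 ≤ p k l (eps n) := by
  unfold p eps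
  positivity

theorem p_eps_sq {n k l : ℕ} (hk : 1 ≤ k) (hn : 2 * k ≤ n) (hl : l ≤ k) :
    p k l (eps n) ^ 2 = (k.factorial * (n - k).factorial * ((n : ℝ) + 1 - 2 * l))
        / (l.factorial * (n + 1 - l).factorial) := by
  obtain ⟨d, rfl⟩ := Nat.exists_eq_add_of_le hl
  obtain ⟨m, rfl⟩ : ∃ m, n = 2 * l + d + m := ⟨n - (2 * l + d), by omega⟩
  have hN : (0 : ℝ) < ((2 * l + d + m : ℕ) : ℝ) := by exact_mod_cast (by omega)
  have hN' : ((2 * l + d + m : ℕ) : ℝ) = 2 * l + d + m := by push_cast; ring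
  set N : ℝ := ((2 * l + d + m : ℕ) : ℝ) with hNdef
  -- The product has d + 1 factors while ε^(2d) supplies only d powers of 1/n; the remaining one
  -- comes from the numerator in `hnum`.
  have hprod : ∏ j ∈ Finset.Icc l (l + d), (1 - ((j : ℝ) - 1) * eps (2 * l + d + m) ^ 2)
      = ((d + 1 + (m + l)).factorial / (m + l).factorial) / N ^ (d + 1) := by
    have h := prod_range_add_sub_mul_factorial (F := ℝ) (d + 1) (m + l)
    have hf : ((m + l).factorial : ℝ) ≠ 0 := by exact_mod_cast (m + l).factorial_ne_zero
    rw [← eq_div_of_mul_eq hf h, ← Finset.Ico_succ_right_eq_Icc, Finset.prod_Ico_eq_prod_range]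
    rw [Order.succ_eq_add_one, show l + d + 1 - l = d + 1 by omega]
    have hc : ∀ i ∈ Finset.range (d + 1), (1 - (((l + i : ℕ) : ℝ) - 1) * eps (2 * l + d + m) ^ 2)
        = (((d + 1 : ℕ) : ℝ) + ((m + l : ℕ) : ℝ) - i) / N := by
      intro i _
      rw [eps_sq, ← hNdef, eq_div_iff hN.ne', sub_mul, mul_assoc, one_div_mul_cancel hN.ne', hN']
      push_cast; ring
    rw [Finset.prod_congr rfl hc, Finset.prod_div_distrib, Finset.prod_const, Finset.card_range]
  have hnum : 1 - (2 * (l : ℝ) - 1) * eps (2 * l + d + m) ^ 2 = (d + m + 1) / N := by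
    rw [eps_sq, ← hNdef, eq_div_iff hN.ne', sub_mul, mul_assoc, one_div_mul_cancel hN.ne', hN']
    ring
  rw [p, mul_pow, hprod, hnum, Real.sq_sqrt (by positivity), Nat.add_sub_cancel_left, ← pow_mul,
    mul_comm d 2, pow_mul, eps_sq, ← hNdef, show 2 * l + d + m - (l + d) = m + l by omega,
    show 2 * l + d + m + 1 - l = d + 1 + (m + l) by omega,
    show N + 1 - 2 * (l : ℝ) = d + m + 1 by rw [hN']; ring]
  have hf : ((m + l).factorial : ℝ) ≠ 0 := by exact_mod_cast (m + l).factorial_ne_zero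
  have hf1 : (l.factorial : ℝ) ≠ 0 := by exact_mod_cast l.factorial_ne_zero
  have hf2 : ((d + 1 + (m + l)).factorial : ℝ) ≠ 0 := by
    exact_mod_cast (d + 1 + (m + l)).factorial_ne_zero
  have hN0 := hN.ne'
  clear_value N
  field_simp
  rw [pow_succ, ← mul_assoc, ← mul_pow, one_div_mul_cancel hN0, one_pow, one_mul]

theorem p_eps_eq_norm {n k l : ℕ} (hk : 1 ≤ k) (hn : 2 * k ≤ n) (hl : l ≤ k) (w : Vertex n k) :
    p k l (eps n) = ‖eigenProj n k l (ket w)‖ := by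
  rw [← sq_eq_sq₀ (p_nonneg k l n) (norm_nonneg _), p_eps_sq hk hn hl,
    norm_sq_eigenProj_ket hn hl w]

theorem p_eps_pos {n k l : ℕ} (hk : 1 ≤ k) (hn : 2 * k ≤ n) (hl : l ≤ k) :
    0 < p k l (eps n) := by
  refine (p_nonneg k l n).lt_of_ne' fun h => ?_
  have h1 := p_eps_sq hk hn hl
  have h2 : (2 * l : ℝ) ≤ n := by exact_mod_cast (by omega : 2 * l ≤ n)
  have h3 : (0 : ℝ) < (n : ℝ) + 1 - 2 * l := by linarith
  rw [h, zero_pow two_ne_zero] at h1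
  have : (0 : ℝ) < (k.factorial * (n - k).factorial * ((n : ℝ) + 1 - 2 * l))
        / (l.factorial * (n + 1 - l).factorial) := by positivity
  exact this.ne h1

theorem gammaCirc_eps {n k : ℕ} (hn : 0 < n) : gammaCirc k (eps n)
    = ∑ l ∈ Finset.Icc 1 k, p k l (eps n) ^ 2 / (eigenval n k 0 - eigenval n k l) := by
  have he : eps n ^ 2 ≠ 0 := by
    rw [eps_sq]; have : (0 : ℝ) < n := by exact_mod_cast hn
    positivity
  rw [gammaCirc, Finset.mul_sum]
  refine Finset.sum_congr rfl fun l _ => ?_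
  rw [r_eps hn, r_eps hn, ← mul_sub, mul_div_assoc', mul_div_mul_left _ _ he]

theorem gammaCirc_eps_pos {n k : ℕ} (hk : 1 ≤ k) (hn : 2 * k ≤ n) :
    0 < gammaCirc k (eps n) := by
  rw [gammaCirc_eps (by omega)]
  refine Finset.sum_pos (fun l hl => ?_) ⟨1, Finset.mem_Icc.2 ⟨le_rfl, hk⟩⟩
  obtain ⟨h1, h2⟩ := Finset.mem_Icc.1 hl
  exact div_pos (pow_pos (p_eps_pos hk hn h2) 2) (sub_pos.2 (eigenval_lt hn h2 h1))

theorem sum_p_eps_sq {n k : ℕ} (hk : 1 ≤ k) (hn : 2 * k ≤ n) :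
    ∑ l ∈ Finset.range (k + 1), p k l (eps n) ^ 2 = 1 := by
  -- The sum up to m telescopes to C(n, m) / C(n, k).
  have partial_sum : ∀ m ≤ k, ∑ l ∈ Finset.range (m + 1), p k l (eps n) ^ 2
      = (k.factorial * (n - k).factorial) / (m.factorial * (n - m).factorial) := by
    intro m hm
    induction m with
    | zero =>
      rw [Finset.sum_range_one, p_eps_sq hk hn hm]
      have hs : ((n + 1 - 0).factorial : ℝ) = (n + 1) * (n - 0).factorial := by
        rw [Nat.sub_zero, Nat.sub_zero, Nat.factorial_succ]; push_cast; ring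
      have : (n : ℝ) + 1 ≠ 0 := by positivity
      have hf : ((n - 0).factorial : ℝ) ≠ 0 := by exact_mod_cast (n - 0).factorial_ne_zero
      rw [hs]
      push_cast
      field_simp
      ring
    | succ m ih =>
      rw [Finset.sum_range_succ, ih (by omega), p_eps_sq hk hn hm]
      obtain ⟨c, rfl⟩ : ∃ c, n = m + 1 + c := ⟨n - (m + 1), by omega⟩
      rw [show m + 1 + c - m = c + 1 by omega, show m + 1 + c + 1 - (m + 1) = c + 1 by omega,
        show m + 1 + c - (m + 1) = c by omega, Nat.factorial_succ m, Nat.factorial_succ c]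
      have f1 : (m.factorial : ℝ) ≠ 0 := by exact_mod_cast m.factorial_ne_zero
      have f2 : (c.factorial : ℝ) ≠ 0 := by exact_mod_cast c.factorial_ne_zero
      have g1 : (m : ℝ) + 1 ≠ 0 := by positivity
      have g2 : (c : ℝ) + 1 ≠ 0 := by positivity
      push_cast
      field_simp
      ring
  rw [partial_sum k le_rfl]
  exact div_self (by positivity)

/-- Pythagoras for combinations of the spectral components of `x`. -/
theorem norm_sq_sum_smul_eigenProj {n k : ℕ} (hn : 2 * k ≤ n) (x : State n k) (c : ℕ → ℝ) :
    ‖∑ l ∈ Finset.range (k + 1), (c l : ℂ) • eigenProj n k l x‖ ^ 2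
      = ∑ l ∈ Finset.range (k + 1), c l ^ 2 * ‖eigenProj n k l x‖ ^ 2 := by
  rw [← Complex.ofReal_inj]
  have h := inner_self_eq_norm_sq_to_K (𝕜 := ℂ)
    (∑ l ∈ Finset.range (k + 1), (c l : ℂ) • eigenProj n k l x)
  have h' : ((‖∑ l ∈ Finset.range (k + 1), (c l : ℂ) • eigenProj n k l x‖ ^ 2 : ℝ) : ℂ)
      = inner ℂ (∑ l ∈ Finset.range (k + 1), (c l : ℂ) • eigenProj n k l x)
          (∑ l ∈ Finset.range (k + 1), (c l : ℂ) • eigenProj n k l x) := by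
    rw [h]; norm_cast
  rw [h', sum_inner, Complex.ofReal_sum]
  refine Finset.sum_congr rfl fun l hl => ?_
  rw [inner_sum, Finset.sum_eq_single_of_mem l hl]
  · rw [inner_smul_left, inner_smul_right, inner_self_eq_norm_sq_to_K, Complex.conj_ofReal]
    push_cast
    simp only [Complex.coe_algebraMap]
    ring
  · intro j hj hjl
    have h1 := Finset.mem_range.1 hl
    have h2 := Finset.mem_range.1 hj
    rw [inner_smul_left, inner_smul_right, inner_eigenProj_eigenProj
      (eigenval_injOn hn (by omega) (by omega) (Ne.symm hjl)), mul_zero, mul_zero]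

/-- The sum S of the components satisfies ‖S‖² = ⟨w, S⟩ = 1 = ‖w‖², and this forces S = w. -/
theorem sum_eigenProj_ket {n k : ℕ} (hk : 1 ≤ k) (hn : 2 * k ≤ n) (w : Vertex n k) :
    ∑ l ∈ Finset.range (k + 1), eigenProj n k l (ket w) = ket w := by
  set S := ∑ l ∈ Finset.range (k + 1), eigenProj n k l (ket w) with hS
  have hsum : ∑ l ∈ Finset.range (k + 1), ‖eigenProj n k l (ket w)‖ ^ 2 = 1 := by
    rw [← sum_p_eps_sq hk hn]
    refine Finset.sum_congr rfl fun l hl => ?_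
    rw [p_eps_eq_norm hk hn (by have := Finset.mem_range.1 hl; omega) w]
  have h1 : ‖S‖ ^ 2 = 1 := by
    have := norm_sq_sum_smul_eigenProj hn (ket w) (fun _ => 1)
    simpa [hsum] using this
  have h2 : inner ℂ (ket w) S = (1 : ℂ) := by
    rw [hS, inner_sum]
    simp only [inner_eigenProj_self]
    exact_mod_cast hsum
  have h3 : ‖S - ket w‖ ^ 2 = 0 := by
    rw [@norm_sub_sq ℂ, h1, norm_ket, ← inner_conj_symm, h2]
    norm_num
  exact sub_eq_zero.1 (norm_eq_zero.1 (pow_eq_zero_iff two_ne_zero |>.1 h3))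

theorem p_zero_eps_sq {n k : ℕ} (hk : 1 ≤ k) (hn : 2 * k ≤ n) :
    p k 0 (eps n) ^ 2 = 1 / (n.choose k : ℝ) := by
  rw [p_eps_sq hk hn (Nat.zero_le k), Nat.cast_choose ℝ (by omega : k ≤ n), Nat.sub_zero,
    Nat.factorial_succ]
  have : (n : ℝ) + 1 ≠ 0 := by positivity
  have hf : (n.factorial : ℝ) ≠ 0 := by exact_mod_cast n.factorial_ne_zero
  push_cast
  field_simp
  simp

theorem uniformState_eq {n k : ℕ} (w : Vertex n k) :
    uniformState n k = ((1 / √(n.choose k : ℝ) : ℝ) : ℂ) • subsetCount w 0 := by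
  rw [uniformState]
  congr 1
  ext v
  simp [subsetCount_apply, ket, Finset.sum_apply, Pi.single_apply]

theorem adjOp_uniformState {n k : ℕ} (w : Vertex n k) :
    adjOp n k (uniformState n k) = (eigenval n k 0 : ℂ) • uniformState n k := by
  rw [uniformState_eq w, map_smul, adjOp_subsetCount_zero, smul_comm]

theorem inner_ket_uniformState {n k : ℕ} (w : Vertex n k) :
    inner ℂ (ket w) (uniformState n k) = ((1 / √(n.choose k : ℝ) : ℝ) : ℂ) := by
  rw [uniformState_eq w, inner_smul_right, inner_ket_subsetCount]
  simp

/-- P_0|w⟩ is a multiple c of u_0, and pairing with w gives c = ‖P_0|w⟩‖² = 1/N. -/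
theorem eigenProj_zero_ket {n k : ℕ} (hk : 1 ≤ k) (hn : 2 * k ≤ n) (w : Vertex n k) :
    eigenProj n k 0 (ket w) = ((1 / √(n.choose k : ℝ) : ℝ) : ℂ) • uniformState n k := by
  have hv : eigenvec w 0 = subsetCount w 0 := by simp [eigenvec, eigenvecCoeff]
  have h1 := eigenProj_ket hn (Nat.zero_le k) w
  have h2 := inner_eigenProj_self 0 (ket w)
  rw [← p_eps_eq_norm hk hn (Nat.zero_le k) w, p_zero_eps_sq hk hn, h1, hv, inner_smul_right,
    inner_ket_subsetCount, Nat.choose_zero_right, Nat.cast_one, mul_one] at h2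
  rw [h1, hv, h2, uniformState_eq w, smul_smul, ← Complex.ofReal_mul]
  congr 2
  rw [div_mul_div_comm, Real.mul_self_sqrt (Nat.cast_nonneg _), one_mul]

theorem norm_uniformState {n k : ℕ} (hk : 1 ≤ k) (hn : 2 * k ≤ n) (w : Vertex n k) :
    ‖uniformState n k‖ = 1 := by
  have h := congrArg (‖·‖) (eigenProj_zero_ket hk hn w)
  have hc : (0 : ℝ) < n.choose k := by exact_mod_cast Nat.choose_pos (by omega)
  have h0 := p_zero_eps_sq hk hn
  have hq : 0 < 1 / √(n.choose k : ℝ) := by positivity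
  simp only [norm_smul, Complex.norm_real, Real.norm_of_nonneg hq.le] at h
  rw [← p_eps_eq_norm hk hn (Nat.zero_le k) w] at h
  have h1 : p k 0 (eps n) = 1 / √(n.choose k : ℝ) := by
    rw [← sq_eq_sq₀ (p_nonneg _ _ _) hq.le, h0, div_pow, one_pow,
      Real.sq_sqrt (Nat.cast_nonneg _)]
  rw [h1] at h
  exact mul_left_cancel₀ hq.ne' (by rw [← h, mul_one])

/-! ### Approximate solutions of the Schrödinger equation. -/

theorem exp_I_smul_mem_unitary {E : Type*} [NormedAddCommGroup E] [InnerProductSpace ℂ E]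
    [CompleteSpace E] {H : E →L[ℂ] E} (hH : IsSelfAdjoint H) (t : ℝ) :
    NormedSpace.exp ((t : ℂ) • (Complex.I • H)) ∈ unitary (E →L[ℂ] E) := by
  let _ : NormedAlgebra ℚ (E →L[ℂ] E) := NormedAlgebra.restrictScalars ℚ ℂ (E →L[ℂ] E)
  refine NormedSpace.exp_mem_unitary_of_mem_skewAdjoint ?_
  rw [skewAdjoint.mem_iff, star_smul, star_smul, hH.star_eq]
  simp

/-- Duhamel's estimate: an approximate solution of `φ' = -iHφ` with defect at most `η` stays
within `ηt` of the exact evolution. -/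
theorem norm_exp_sub_le_of_defect {E : Type*} [NormedAddCommGroup E] [InnerProductSpace ℂ E]
    [CompleteSpace E] {H : E →L[ℂ] E} (hH : IsSelfAdjoint H) {φ φ' : ℂ → E}
    (hφ : ∀ z, HasDerivAt φ (φ' z) z) {η : ℝ}
    (hη : ∀ t : ℝ, ‖φ' t + Complex.I • H (φ t)‖ ≤ η) {T : ℝ} (hT : 0 ≤ T) :
    ‖NormedSpace.exp ((-Complex.I * (T : ℂ)) • H) (φ 0) - φ T‖ ≤ η * T := by
  set U : ℂ → E →L[ℂ] E := fun z => NormedSpace.exp (z • (Complex.I • H)) with hU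
  have hunit : ∀ (t : ℝ) (x : E), ‖U t x‖ = ‖x‖ := fun t x =>
    ContinuousLinearMap.norm_map_of_mem_unitary (exp_I_smul_mem_unitary hH t) x
  have hder : ∀ z, HasDerivAt (fun z => U z (φ z)) (U z (φ' z + Complex.I • H (φ z))) z := by
    intro z
    -- In the interaction picture z ↦ U(z) φ(z) the derivative is U applied to the defect, and U is
    -- isometric at real times.
    have h := (hasDerivAt_exp_smul_const (Complex.I • H) z).clm_apply (hφ z)
    refine h.congr_deriv ?_
    rw [map_add, add_comm]
    rfl
  have hreal : ∀ t : ℝ, HasDerivAt (fun t : ℝ => U t (φ t))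
      (U t (φ' t + Complex.I • H (φ t))) t := by
    intro t
    have h := (hder (t : ℂ)).scomp t (Complex.ofRealCLM.hasDerivAt (x := t))
    simpa [Function.comp_def] using h
  have hmain := norm_image_sub_le_of_norm_deriv_le_segment' (a := 0) (b := T)
    (fun t _ => (hreal t).hasDerivWithinAt) (C := η)
    (fun t _ => by rw [hunit]; exact hη t) T ⟨hT, le_rfl⟩
  have hU0 : U ((0 : ℝ) : ℂ) = 1 := by simp [hU]
  have hinv : ∀ x, U T (NormedSpace.exp ((-Complex.I * (T : ℂ)) • H) x) = x := by
    intro x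
    let _ : NormedAlgebra ℚ (E →L[ℂ] E) := NormedAlgebra.restrictScalars ℚ ℂ (E →L[ℂ] E)
    have he : (-Complex.I * (T : ℂ)) • H = -((T : ℂ) • (Complex.I • H)) := by module
    have hm : U T * NormedSpace.exp ((-Complex.I * (T : ℂ)) • H) = 1 := by
      rw [he, hU, ← NormedSpace.exp_add_of_commute (Commute.refl _).neg_right, add_neg_cancel,
        NormedSpace.exp_zero]
    exact congrArg (fun A : E →L[ℂ] E => A x) hm
  rw [← hunit T, map_sub, hinv, norm_sub_rev]
  rw [hU0, sub_zero] at hmain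
  simpa using hmain

/-- Rotation in an approximately invariant plane: if `(H - E)s = -ω w` and `(H - E)b = -ω s`, the
evolution of `s` follows `e^{-iEt}(cos(ωt) s + i sin(ωt) b)` up to `ωt‖b - w‖`. -/
theorem norm_exp_sub_rotation_le {V : Type*} [NormedAddCommGroup V] [InnerProductSpace ℂ V]
    [CompleteSpace V] {H : V →L[ℂ] V} (hH : IsSelfAdjoint H) {E ω : ℝ} (hω : 0 ≤ ω) {s w b : V}
    (hs : H s = (E : ℂ) • s - (ω : ℂ) • w) (hb : H b = (E : ℂ) • b - (ω : ℂ) • s)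
    {T : ℝ} (hT : 0 ≤ T) :
    ‖NormedSpace.exp ((-Complex.I * (T : ℂ)) • H) s - Complex.exp (-(Complex.I * E * T)) •
        (Complex.cos (ω * T) • s + (Complex.I * Complex.sin (ω * T)) • b)‖
      ≤ ω * ‖b - w‖ * T := by
  set φ : ℂ → V := fun z => Complex.exp (-(Complex.I * E * z)) •
        (Complex.cos (ω * z) • s + (Complex.I * Complex.sin (ω * z)) • b) with hφ
  have hlin : ∀ (c z : ℂ), HasDerivAt (fun z => c * z) c z := fun c z => by
    simpa using (hasDerivAt_id z).const_mul c
  have hder : ∀ z, HasDerivAt φ (Complex.exp (-(Complex.I * E * z)) •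
        ((-Complex.sin (ω * z) * ω) • s + (Complex.I * (Complex.cos (ω * z) * ω)) • b)
        + (Complex.exp (-(Complex.I * E * z)) * -(Complex.I * E)) •
        (Complex.cos (ω * z) • s + (Complex.I * Complex.sin (ω * z)) • b)) z := by
    intro z
    exact ((hlin (Complex.I * E) z).neg.cexp).smul
      (((hlin ω z).ccos.smul_const s).add (((hlin ω z).csin.const_mul Complex.I).smul_const b))
  have h := norm_exp_sub_le_of_defect hH hder (η := ω * ‖b - w‖) (fun t => ?_) hT
  · have h0 : φ 0 = s := by simp [hφ]
    rwa [h0] at h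
  -- All terms in s cancel; the only mismatch is that H s produces w where the rotation needs b.
  · have hdef : Complex.exp (-(Complex.I * E * t)) •
        ((-Complex.sin (ω * t) * ω) • s + (Complex.I * (Complex.cos (ω * t) * ω)) • b)
        + (Complex.exp (-(Complex.I * E * t)) * -(Complex.I * E)) •
        (Complex.cos (ω * t) • s + (Complex.I * Complex.sin (ω * t)) • b)
        + Complex.I • H (φ t)
        = (Complex.exp (-(Complex.I * E * t)) * Complex.I * Complex.cos (ω * t) * ω) •
          (b - w) := by
      simp only [hφ, map_smul, map_add, hs, hb]
      match_scalars
      · linear_combination (-ω * Complex.sin (ω * t) * Complex.exp (-(Complex.I * E * t)))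
          * Complex.I_sq
      · ring
      · ring
    rw [hdef, norm_smul]
    refine mul_le_mul_of_nonneg_right ?_ (norm_nonneg _)
    have h1 : ‖Complex.exp (-(Complex.I * E * t))‖ = 1 := by
      rw [show -(Complex.I * E * t) = ((-(E * t) : ℝ) : ℂ) * Complex.I by push_cast; ring,
        Complex.norm_exp_ofReal_mul_I]
    have h2 : ‖Complex.cos (ω * t)‖ ≤ 1 := by
      rw [← Complex.ofReal_mul, ← Complex.ofReal_cos, Complex.norm_real]
      exact Real.abs_cos_le_one _
    rw [norm_mul, norm_mul, norm_mul, h1, Complex.norm_I, Complex.norm_real,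
      Real.norm_of_nonneg hω]
    nlinarith

/-! ### The search Hamiltonian and the partner of the marked state. -/

theorem hamiltonian_apply {n k : ℕ} (γ : ℝ) (w : Vertex n k) (x : State n k) :
    hamiltonian γ w x = -((γ : ℂ) • adjOp n k x) - inner ℂ (ket w) x • ket w := by
  simp [hamiltonian, InnerProductSpace.rankOne_apply]

theorem hamiltonian_isSelfAdjoint {n k : ℕ} (γ : ℝ) (w : Vertex n k) :
    IsSelfAdjoint (hamiltonian γ w) := by
  have h1 : IsSelfAdjoint (adjOp n k) := (adjOp_isSymmetric n k).isSelfAdjoint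
  have h2 : IsSelfAdjoint (InnerProductSpace.rankOne ℂ (ket w) (ket w)) :=
    LinearMap.IsSymmetric.isSelfAdjoint (InnerProductSpace.isSymmetric_rankOne_self (ket w))
  have h3 : IsSelfAdjoint ((γ : ℂ)) := Complex.conj_ofReal γ
  exact (h3.smul h1).neg.sub h2

/-- The weights `1/(γ°(λ_0 - λ_l))` for `l ≥ 1`, and `0` for `l = 0`. -/
def partnerWeight (n k l : ℕ) : ℝ :=
  if l = 0 then 0 else 1 / (gammaCirc k (eps n) * (eigenval n k 0 - eigenval n k l))

/-- The vector close to `|w⟩` that the Hamiltonian at `γ°` maps, up to the shift by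
`-γ°λ_0`, exactly to a multiple of the uniform state. -/
def partner {n k : ℕ} (w : Vertex n k) : State n k :=
  ∑ l ∈ Finset.range (k + 1), (partnerWeight n k l : ℂ) • eigenProj n k l (ket w)

/-- This is the condition that fixes γ°: the pairing equals (1/γ°) ∑_{l≥1} p_l² / (λ_0 - λ_l). -/
theorem inner_ket_partner {n k : ℕ} (hk : 1 ≤ k) (hn : 2 * k ≤ n) (w : Vertex n k) :
    inner ℂ (ket w) (partner w) = (1 : ℂ) := by
  have hγ := gammaCirc_eps_pos hk hn
  have hsum : ∑ l ∈ Finset.range (k + 1), partnerWeight n k l * p k l (eps n) ^ 2 = 1 := by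
    rw [Finset.range_eq_Ico, Finset.sum_eq_sum_Ico_succ_bot (Nat.succ_pos k)]
    have h1 : ∀ l ∈ Finset.Ico (0 + 1) (k + 1), partnerWeight n k l * p k l (eps n) ^ 2
        = (gammaCirc k (eps n))⁻¹ *
          (p k l (eps n) ^ 2 / (eigenval n k 0 - eigenval n k l)) := by
      intro l hl
      have hl0 : l ≠ 0 := by have := (Finset.mem_Ico.1 hl).1; omega
      rw [partnerWeight, if_neg hl0, one_div, mul_inv]
      ring
    rw [Finset.sum_congr rfl h1, ← Finset.mul_sum, zero_add, Finset.Ico_add_one_right_eq_Icc,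
      ← gammaCirc_eps (by omega : 0 < n), inv_mul_cancel₀ hγ.ne']
    simp [partnerWeight]
  rw [partner, inner_sum, ← Complex.ofReal_one, ← hsum, Complex.ofReal_sum]
  refine Finset.sum_congr rfl fun l hl => ?_
  rw [inner_smul_right, inner_eigenProj_self,
    p_eps_eq_norm hk hn (by have := Finset.mem_range.1 hl; omega) w, Complex.ofReal_mul]

theorem hamiltonian_uniformState {n k : ℕ} (γ : ℝ) (w : Vertex n k) :
    hamiltonian γ w (uniformState n k) = ((-(γ * eigenval n k 0) : ℝ) : ℂ) • uniformState n k
      - ((1 / √(n.choose k : ℝ) : ℝ) : ℂ) • ket w := by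
  rw [hamiltonian_apply, adjOp_uniformState w, inner_ket_uniformState]
  push_cast
  module

/-- The weights invert γ°(λ_0 - A) off the λ_0 component, so γ°(λ_0 - A)b = w - P_0 w. The rank-one
term subtracts ⟨w, b⟩w = w, which leaves -P_0 w = -ω s. -/
theorem hamiltonian_partner {n k : ℕ} (hk : 1 ≤ k) (hn : 2 * k ≤ n) (w : Vertex n k) :
    hamiltonian (gammaCirc k (eps n)) w (partner w)
      = ((-(gammaCirc k (eps n) * eigenval n k 0) : ℝ) : ℂ) • partner w
      - ((1 / √(n.choose k : ℝ) : ℝ) : ℂ) • uniformState n k := by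
  have hγ := gammaCirc_eps_pos hk hn
  set γ := gammaCirc k (eps n) with hγdef
  rw [hamiltonian_apply, inner_ket_partner hk hn, one_smul, ← eigenProj_zero_ket hk hn w]
  have key : ((γ * eigenval n k 0 : ℝ) : ℂ) • partner w - (γ : ℂ) • adjOp n k (partner w)
      = ket w - eigenProj n k 0 (ket w) := by
    have htail : ket w - eigenProj n k 0 (ket w)
        = ∑ l ∈ Finset.range k, eigenProj n k (l + 1) (ket w) := by
      rw [sub_eq_iff_eq_add, ← Finset.sum_range_succ' (fun l => eigenProj n k l (ket w)),
        sum_eigenProj_ket hk hn w]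
    rw [htail, partner, map_sum, Finset.smul_sum, Finset.smul_sum, ← Finset.sum_sub_distrib,
      Finset.sum_range_succ']
    have h0 : partnerWeight n k 0 = 0 := if_pos rfl
    simp only [h0, Complex.ofReal_zero, zero_smul, map_zero, smul_zero, sub_zero, add_zero]
    refine Finset.sum_congr rfl fun l hl => ?_
    have hl := Finset.mem_range.1 hl
    have hgap := sub_pos.2 (eigenval_lt hn (by omega : l + 1 ≤ k) (Nat.succ_pos l))
    have hw : γ * (eigenval n k 0 - eigenval n k (l + 1)) * partnerWeight n k (l + 1) = 1 := by
      rw [partnerWeight, if_neg (Nat.succ_ne_zero l), ← hγdef]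
      exact mul_one_div_cancel (mul_pos hγ hgap).ne'
    rw [map_smul, adjOp_eigenProj, smul_smul, smul_smul, smul_smul, ← sub_smul]
    have hw' := congrArg (fun x : ℝ => (x : ℂ)) hw
    push_cast at hw' ⊢
    have : (γ : ℂ) * (eigenval n k 0) * (partnerWeight n k (l + 1))
        - γ * ((partnerWeight n k (l + 1)) * (eigenval n k (l + 1))) = 1 := by
      rw [← hw']; ring
    rw [← mul_assoc] at this
    rw [this, one_smul]
  have hneg : ((-(γ * eigenval n k 0) : ℝ) : ℂ) = -((γ * eigenval n k 0 : ℝ) : ℂ) := by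
    push_cast; ring
  rw [hneg, neg_smul]
  have h2 : ((γ * eigenval n k 0 : ℝ) : ℂ) • partner w
      = ket w - eigenProj n k 0 (ket w) + (γ : ℂ) • adjOp n k (partner w) := by
    rw [← key]; abel
  rw [h2]
  abel

/-! ### Limits as ε → 0 and n → ∞. -/

/-- `‖b - w‖²` for the partner `b` of `|w⟩`, as a function of `ε`. -/
def partnerError (k : ℕ) (ε : ℝ) : ℝ :=
  p k 0 ε ^ 2 + ∑ l ∈ Finset.Icc 1 k, (1 / ((∑ j ∈ Finset.Icc 1 k,
    p k j ε ^ 2 / (r k 0 ε - r k j ε)) * (r k 0 ε - r k l ε)) - 1) ^ 2 * p k l ε ^ 2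

/-- The factor ε² in γ° turns the gaps of λ into gaps of r, which have the nonzero limits l as ε →
0, so the limit can be taken by continuity. -/
theorem norm_partner_sub_ket_sq {n k : ℕ} (hk : 1 ≤ k) (hn : 2 * k ≤ n) (w : Vertex n k) :
    ‖partner w - ket w‖ ^ 2 = partnerError k (eps n) := by
  have h1 : partner w - ket w = ∑ l ∈ Finset.range (k + 1),
      ((partnerWeight n k l - 1 : ℝ) : ℂ) • eigenProj n k l (ket w) := by
    simp only [Complex.ofReal_sub, Complex.ofReal_one, sub_smul, one_smul,
      Finset.sum_sub_distrib, sum_eigenProj_ket hk hn w]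
    rfl
  rw [h1, norm_sq_sum_smul_eigenProj hn, Finset.range_eq_Ico,
    Finset.sum_eq_sum_Ico_succ_bot (Nat.succ_pos k), zero_add, Nat.succ_eq_add_one,
    Finset.Ico_add_one_right_eq_Icc, partnerError]
  congr 1
  · rw [p_eps_eq_norm hk hn (Nat.zero_le k) w]
    simp [partnerWeight]
  · refine Finset.sum_congr rfl fun l hl => ?_
    obtain ⟨hl1, hl2⟩ := Finset.mem_Icc.1 hl
    rw [p_eps_eq_norm hk hn hl2 w, partnerWeight, if_neg (by omega), gammaCirc,
      r_eps (by omega) k 0, r_eps (by omega) k l, ← mul_sub]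
    congr 4
    ring

theorem continuousAt_p (k l : ℕ) : ContinuousAt (p k l) 0 := by
  unfold p
  refine ContinuousAt.mul (by fun_prop) (ContinuousAt.sqrt (ContinuousAt.div ?_ ?_ ?_))
  · fun_prop
  · refine ContinuousAt.mul continuousAt_const ?_
    exact Continuous.continuousAt (continuous_finsetProd _ fun j _ => by fun_prop)
  · simp [Nat.factorial_ne_zero]

theorem p_at_zero_self (k : ℕ) : p k k 0 = 1 := by
  simp [p, Nat.factorial_ne_zero]

theorem p_at_zero_of_lt {k l : ℕ} (h : l < k) : p k l 0 = 0 := by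
  simp [p, Nat.sub_ne_zero_of_lt h]

theorem continuous_r (k l : ℕ) : Continuous (r k l) := by
  unfold r; fun_prop

theorem r_at_zero_sub (k l : ℕ) : r k 0 0 - r k l 0 = l := by
  simp [r]

/-- At ε = 0 only p_k = 1 survives. The sum defining γ°/ε² is then 1/k and the gap at l = k is k, so
the one remaining weight is exactly 1. -/
theorem tendsto_partnerError {k : ℕ} (hk : 1 ≤ k) :
    Tendsto (partnerError k) (𝓝 0) (𝓝 0) := by
  have hsum : ∑ j ∈ Finset.Icc 1 k, p k j 0 ^ 2 / (r k 0 0 - r k j 0) = 1 / k := by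
    rw [Finset.sum_eq_single_of_mem k (Finset.mem_Icc.2 ⟨hk, le_rfl⟩), p_at_zero_self,
      r_at_zero_sub, one_pow]
    intro j hj hjk
    rw [p_at_zero_of_lt (lt_of_le_of_ne (Finset.mem_Icc.1 hj).2 hjk)]
    simp
  have hk0 : (k : ℝ) ≠ 0 := by exact_mod_cast (by omega : k ≠ 0)
  have hcont : ContinuousAt (partnerError k) 0 := by
    unfold partnerError
    refine ((continuousAt_p k 0).pow 2).add (tendsto_finsetSum _ fun l hl => ?_)
    have hl0 : (l : ℝ) ≠ 0 := by
      have := (Finset.mem_Icc.1 hl).1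
      exact_mod_cast (by omega : l ≠ 0)
    have hr : ∀ j, ContinuousAt (fun ε => r k 0 ε - r k j ε) 0 := fun j =>
      ((continuous_r k 0).sub (continuous_r k j)).continuousAt
    have hG : ContinuousAt (fun ε => ∑ j ∈ Finset.Icc 1 k,
        p k j ε ^ 2 / (r k 0 ε - r k j ε)) 0 := by
      refine tendsto_finsetSum _ fun j hj => ?_
      refine ((continuousAt_p k j).pow 2).div (hr j) ?_
      rw [r_at_zero_sub]
      have := (Finset.mem_Icc.1 hj).1
      exact_mod_cast (by omega : j ≠ 0)
    refine (((continuousAt_const.div (hG.mul (hr l)) ?_).sub continuousAt_const).pow 2).mul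
      ((continuousAt_p k l).pow 2)
    rw [Pi.mul_apply, hsum, r_at_zero_sub]
    exact mul_ne_zero (one_div_ne_zero hk0) hl0
  have hval : partnerError k 0 = 0 := by
    rw [partnerError, hsum, p_at_zero_of_lt (by omega : 0 < k), zero_pow two_ne_zero, zero_add]
    refine Finset.sum_eq_zero fun l hl => ?_
    rcases eq_or_lt_of_le (Finset.mem_Icc.1 hl).2 with rfl | h
    · rw [r_at_zero_sub, one_div_mul_cancel hk0]
      norm_num
    · rw [p_at_zero_of_lt h]
      ring
  have h := hcont.tendsto
  rwa [hval] at h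

theorem tendsto_eps : Tendsto eps atTop (𝓝 0) := by
  unfold eps
  simp only [one_div]
  exact tendsto_inv_atTop_zero.comp (Real.tendsto_sqrt_atTop.comp tendsto_natCast_atTop_atTop)

/-- Square root of the equivalence C(n, k) ~ n^k / k!. -/
theorem tendsto_runTime_div (k : ℕ) :
    Tendsto (fun n : ℕ => runTime n k / (Real.pi * √(n.choose k : ℝ) / 2)) atTop (𝓝 1) := by
  have h1 : Tendsto ((fun n : ℕ => (n : ℝ) ^ k / k.factorial) / fun n : ℕ => (n.choose k : ℝ))
      atTop (𝓝 1) := by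
    refine (Asymptotics.isEquivalent_iff_tendsto_one ?_).1 (isEquivalent_choose k).symm
    filter_upwards [eventually_ge_atTop k] with n hn
    exact_mod_cast (Nat.choose_pos hn).ne'
  have h2 := (Real.continuous_sqrt.tendsto 1).comp h1
  rw [Real.sqrt_one] at h2
  refine h2.congr fun n => ?_
  have h3 : √((n : ℝ) ^ k) = (n : ℝ) ^ ((k : ℝ) / 2) := by
    rw [Real.sqrt_eq_rpow, ← Real.rpow_natCast, ← Real.rpow_mul (Nat.cast_nonneg n)]
    congr 1; ring
  simp only [Function.comp_apply, Pi.div_apply]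
  rw [Real.sqrt_div' _ (Nat.cast_nonneg _), Real.sqrt_div' _ (Nat.cast_nonneg _), h3, runTime]
  have := Real.pi_ne_zero
  rw [div_div, div_div_eq_mul_div, div_mul_eq_mul_div, div_div,
    ← mul_div_mul_left _ _ (mul_ne_zero this (two_ne_zero (α := ℝ)))]
  congr 1 <;> ring

theorem runTime_nonneg (n k : ℕ) : 0 ≤ runTime n k := by
  unfold runTime
  have := Real.pi_pos
  positivity

/-! ### The success probability. -/

/-- The four errors are the Duhamel drift, the remaining s component, the replacement of b by w, and
the deviation of the sine from 1. The comparison vector is w times a phase. -/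
theorem norm_inner_stateAt_sub_le {n k : ℕ} (hk : 1 ≤ k) (hn : 2 * k ≤ n) (w : Vertex n k)
    {T : ℝ} (hT : 0 ≤ T) :
    |‖inner ℂ (ket w) (stateAt (gammaCirc k (eps n)) w T)‖ - 1|
      ≤ 1 / √(n.choose k : ℝ) * T * √(partnerError k (eps n))
        + |Real.cos (1 / √(n.choose k : ℝ) * T)| + √(partnerError k (eps n))
        + |Real.sin (1 / √(n.choose k : ℝ) * T) - 1| := by
  set ω : ℝ := 1 / √(n.choose k : ℝ) with hω
  have hω0 : 0 ≤ ω := by positivity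
  set γ := gammaCirc k (eps n)
  set E : ℝ := -(γ * eigenval n k 0)
  have he : ‖partner w - ket w‖ = √(partnerError k (eps n)) := by
    rw [← norm_partner_sub_ket_sq hk hn w, Real.sqrt_sq (norm_nonneg _)]
  have hrot := norm_exp_sub_rotation_le (hamiltonian_isSelfAdjoint γ w) hω0
    (hamiltonian_uniformState γ w) (hamiltonian_partner hk hn w) hT
  change ‖stateAt γ w T - _‖ ≤ _ at hrot
  rw [he] at hrot
  set c : ℂ := Complex.exp (-(Complex.I * E * T)) with hc
  have hc1 : ‖c‖ = 1 := by
    rw [hc, show -(Complex.I * E * T) = ((-(E * T) : ℝ) : ℂ) * Complex.I by push_cast; ring,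
      Complex.norm_exp_ofReal_mul_I]
  have hcos : Complex.cos (ω * T) = (Real.cos (ω * T) : ℂ) := by push_cast; rfl
  have hsin : Complex.sin (ω * T) = (Real.sin (ω * T) : ℂ) := by push_cast; rfl
  rw [hcos, hsin] at hrot
  set φ : State n k := c • (((Real.cos (ω * T) : ℝ) : ℂ) • uniformState n k
    + (Complex.I * ((Real.sin (ω * T) : ℝ) : ℂ)) • partner w) with hφ
  have hφw : ‖φ - (c * Complex.I) • ket w‖
      ≤ |Real.cos (ω * T)| + √(partnerError k (eps n)) + |Real.sin (ω * T) - 1| := by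
    have hsplit : φ - (c * Complex.I) • ket w
        = c • (((Real.cos (ω * T) : ℝ) : ℂ) • uniformState n k
          + (Complex.I * ((Real.sin (ω * T) : ℝ) : ℂ)) • (partner w - ket w)
          + (Complex.I * ((Real.sin (ω * T) - 1 : ℝ) : ℂ)) • ket w) := by
      rw [hφ]; push_cast; module
    rw [hsplit, norm_smul, hc1, one_mul]
    refine (norm_add₃_le).trans ?_
    simp only [norm_smul, norm_mul, Complex.norm_I, Complex.norm_real, Real.norm_eq_abs, one_mul,
      norm_ket, norm_uniformState hk hn w, mul_one, he]
    have h1 := Real.abs_sin_le_one (ω * T)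
    have h2 := Real.sqrt_nonneg (partnerError k (eps n))
    have h3 : |Real.sin (ω * T)| * √(partnerError k (eps n)) ≤ √(partnerError k (eps n)) :=
      mul_le_of_le_one_left h2 h1
    linarith
  have hdist : ‖stateAt γ w T - (c * Complex.I) • ket w‖
      ≤ ω * T * √(partnerError k (eps n)) + |Real.cos (ω * T)| + √(partnerError k (eps n))
        + |Real.sin (ω * T) - 1| := by
    have h := norm_sub_le_norm_sub_add_norm_sub (stateAt γ w T) φ ((c * Complex.I) • ket w)
    have hcomm : ω * √(partnerError k (eps n)) * T = ω * T * √(partnerError k (eps n)) := by ring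
    linarith
  refine le_trans ?_ hdist
  have hinner : inner ℂ (ket w) (stateAt γ w T - (c * Complex.I) • ket w)
      = inner ℂ (ket w) (stateAt γ w T) - c * Complex.I := by
    rw [inner_sub_right, inner_smul_right, inner_self_eq_norm_sq_to_K, norm_ket]
    simp
  have h1 := norm_inner_le_norm (𝕜 := ℂ) (ket w) (stateAt γ w T - (c * Complex.I) • ket w)
  rw [hinner, norm_ket, one_mul] at h1
  have h2 := abs_norm_sub_norm_le (inner ℂ (ket w) (stateAt γ w T)) (c * Complex.I)
  rw [norm_mul, hc1, Complex.norm_I, one_mul] at h2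
  exact h2.trans h1

theorem tendsto_rotation_error {k : ℕ} (hk : 1 ≤ k) :
    Tendsto (fun n : ℕ => 1 / √(n.choose k : ℝ) * runTime n k * √(partnerError k (eps n))
        + |Real.cos (1 / √(n.choose k : ℝ) * runTime n k)| + √(partnerError k (eps n))
        + |Real.sin (1 / √(n.choose k : ℝ) * runTime n k) - 1|) atTop (𝓝 0) := by
  have hangle : Tendsto (fun n : ℕ => 1 / √(n.choose k : ℝ) * runTime n k) atTop
      (𝓝 (Real.pi / 2)) := by
    have h := (tendsto_runTime_div k).mul_const (Real.pi / 2)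
    rw [one_mul] at h
    refine h.congr fun n => ?_
    have := Real.pi_ne_zero
    field_simp
  have herr : Tendsto (fun n : ℕ => √(partnerError k (eps n))) atTop (𝓝 0) := by
    have h := (Real.continuous_sqrt.tendsto 0).comp ((tendsto_partnerError hk).comp tendsto_eps)
    rwa [Real.sqrt_zero] at h
  have hcos := ((Real.continuous_cos.tendsto _).comp hangle).abs
  have hsin := (((Real.continuous_sin.tendsto _).comp hangle).sub_const 1).abs
  have h := (((hangle.mul herr).add hcos).add herr).add hsin
  simpa using h

theorem eventually_abs_successProb_sub_one_lt {k : ℕ} (hk : 1 ≤ k) {δ : ℝ} (hδ : 0 < δ) :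
    ∀ᶠ n : ℕ in atTop, ∀ w : Vertex n k,
      |successProb (gammaCirc k (eps n)) w (runTime n k) - 1| < δ := by
  have hD := tendsto_rotation_error hk
  filter_upwards [eventually_ge_atTop (2 * k),
    -- The bound 1 gives |a + 1| < 3 for the amplitude a, so δ/3 suffices for a² - 1 = (a - 1)(a +
    -- 1).
    hD.eventually_lt_const (lt_min (show (0 : ℝ) < 1 by norm_num) (by positivity : 0 < δ / 3))]
    with n hn hlt w
  have h := (norm_inner_stateAt_sub_le hk hn w (runTime_nonneg n k)).trans_lt hlt
  obtain ⟨h1, h3⟩ := lt_min_iff.1 h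
  rw [successProb]
  set a := ‖inner ℂ (ket w) (stateAt (gammaCirc k (eps n)) w (runTime n k))‖
  have hfac : a ^ 2 - 1 = (a - 1) * (a + 1) := by ring
  have ha : |a + 1| < 3 := by
    rw [abs_lt] at h1 ⊢
    constructor <;> linarith [h1.1, h1.2]
  rw [hfac, abs_mul]
  nlinarith [abs_nonneg (a - 1), abs_nonneg (a + 1)]

end JohnsonSearch

end

theorem mainTheorem1 (k : ℕ) (hk : 1 ≤ k) :
    -- `γ°` is positive, and `r_ℓ`, `p_ℓ` are `ε² λ_ℓ` and `‖P_ℓ|w⟩‖` at `ε = 1/√n`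
    (∀ n : ℕ, 2 * k ≤ n →
      0 < JohnsonSearch.gammaCirc k (JohnsonSearch.eps n) ∧
      ∀ l ≤ k,
        JohnsonSearch.r k l (JohnsonSearch.eps n)
          = JohnsonSearch.eps n ^ 2 * JohnsonSearch.eigenval n k l ∧
        ∀ w : JohnsonSearch.Vertex n k,
          JohnsonSearch.p k l (JohnsonSearch.eps n)
            = ‖JohnsonSearch.eigenProj n k l (JohnsonSearch.ket w)‖) ∧
    -- `t_run ~ π√N/2`
    Tendsto (fun n : ℕ => JohnsonSearch.runTime n k / (Real.pi * √(n.choose k : ℝ) / 2))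
      atTop (𝓝 1) ∧
    -- the success probability is `1 + o(1)`, uniformly in the marked vertex
    ∀ δ : ℝ, 0 < δ → ∀ᶠ n : ℕ in atTop, ∀ w : JohnsonSearch.Vertex n k,
      |JohnsonSearch.successProb (JohnsonSearch.gammaCirc k (JohnsonSearch.eps n)) w
          (JohnsonSearch.runTime n k) - 1| < δ := by
  refine ⟨fun n hn => ⟨JohnsonSearch.gammaCirc_eps_pos hk hn, fun l hl =>
      ⟨JohnsonSearch.r_eps (by omega) k l, JohnsonSearch.p_eps_eq_norm hk hn hl⟩⟩,
    JohnsonSearch.tendsto_runTime_div k,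
    fun δ hδ => JohnsonSearch.eventually_abs_successProb_sub_one_lt hk hδ⟩
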